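/- Let $R$ be a two-sided noetherian ring and $n\ge 1$ an integer. Let $\operatorname{mod}R$ and $\operatorname{mod}R^{\mathrm{op}}$ be the categories of finitely generated right and left $R$-modules. For a full subcategory $\mathcal X$ of $\operatorname{mod}R$ (all subcategories being closed under isomorphism), its stable category $\underline{\mathcal X}$ has the same objects, and its morphisms are the homomorphisms modulo those factoring through finitely generated projective modules. For a projective presentation $P_1\xrightarrow{d_1}P_0\to M\to 0$ with $P_0,P_1$ finitely generated, put $\Omega M=\operatorname{Im}d_1$ and $\operatorname{Tr}M=\operatorname{Coker}(\operatorname{Hom}_R(d_1,R))$; these induce a functor $\Omega:\underline{\operatorname{mod}R}\to\underline{\operatorname{mod}R}$ and a contravariant functor $\operatorname{Tr}:\underline{\operatorname{mod}R}\to\underline{\operatorname{mod}R^{\mathrm{op}}}$, and $\Omega^n$ is the $n$-fold iterate of $\Omega$. The same notions are used with $R$ and $R^{\mathrm{op}}$ interchanged. For $a,b\in\mathbb Z_{\ge0}\cup\{\infty\}$ let $\mathcal G_{a,b}(R)$ consist of the $M\in\operatorname{mod}R$ with $\operatorname{Ext}^i_R(M,R)=0$ for all integers $1\le i\le a$ and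 $\operatorname{Ext}^j_{R^{\mathrm{op}}}(\operatorname{Tr}M,R)=0$ for all integers $1\le j\le b$. Let $\mathsf{Ref}^{\mathsf T}(R)$ consist of the totally reflexive modules: those $M\in\operatorname{mod}R$ for which, with $M^*=\operatorname{Hom}_R(M,R)$, the evaluation map $M\to M^{**}$ is bijective and $\operatorname{Ext}^i_R(M,R)=0=\operatorname{Ext}^i_{R^{\mathrm{op}}}(M^*,R)$ for all $i\ge1$. Let $\mathsf{Grd}_n(R)$ consist of the $M\in\operatorname{mod}R$ of grade at least $n$, where the grade of $M$ is $\inf\{i\ge0:\operatorname{Ext}^i_R(M,R)\ne0\}\in\mathbb Z_{\ge0}\cup\{\infty\}$. For subcategories $\mathcal X,\mathcal Y$, let $\mathcal X*\mathcal Y$ consist of the $M$ admitting an exact sequence $0\to L\to M\to N\to0$ with $L\in\mathcal X$ and $N\in\mathcal Y$. Let $\mathsf{Sph}_n^{\mathcal X}(R)$ consist of the $M\in\operatorname{mod}R$ with $\operatorname{Ext}^i_R(M,R)=0$ for $1\le i\le n-1$ and $\Omega^nM\in\mathcal X$. A module is called $n$-spherical if it lies in this subcategory for $\mathcal X=\operatorname{proj}(R)$,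 the finitely generated projective modules, and $n$-G-spherical if it does for $\mathcal X=\mathsf{Ref}^{\mathsf T}(R)$. Write $\mathsf{Sph}_n(R)$ and $\mathsf{Sph}_n^{\mathsf G}(R)$ for the subcategories of these modules. 1. The contravariant functors $\operatorname{Ext}^n_R(-,R):\underline{\mathsf{Sph}_n(R)}\to\mathsf{Grd}_n(R^{\mathrm{op}})$ and $\operatorname{Tr}\Omega^{n-1}:\mathsf{Grd}_n(R^{\mathrm{op}})\to\underline{\mathsf{Sph}_n(R)}$ are well defined and are mutually quasi-inverse; that is, they give an equivalence $\underline{\mathsf{Sph}_n(R)}^{\mathrm{op}}\simeq\mathsf{Grd}_n(R^{\mathrm{op}})$ (the target is not a stable category). 2. For every $m\in\mathbb Z_{\ge n}\cup\{\infty\}$, the contravariant functors $\operatorname{Tr}\Omega^{n-1}$ in both directions are well defined and mutually quasi-inverse between $\underline{\mathsf{Sph}_n^{\mathcal G_{m,m+1}(R)}(R)}$ and $\underline{\mathsf{Grd}_n(R^{\mathrm{op}})*\mathcal G_{m,m+1}(R^{\mathrm{op}})}$, where $\infty+1=\infty$. 3. Likewise, the contravariant functors $\operatorname{Tr}\Omega^{n-1}$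 in both directions are well defined and mutually quasi-inverse between $\underline{\mathsf{Sph}_n^{\mathsf G}(R)}$ and $\underline{\mathsf{Grd}_n(R^{\mathrm{op}})*\mathsf{Ref}^{\mathsf T}(R^{\mathrm{op}})}$. -/

import Mathlib

open CategoryTheory

universe u

noncomputable section

namespace StableMod

/-! ### The stable category of finitely generated modules -/

section Stable

variable (A : Type u) [Ring A]

/-- Two homomorphisms of finitely generated modules are identified when their difference factors
through a finitely generated projective module. -/
def projRel : HomRel (FGModuleCat.{u} A) := fun M N f g =>
  ∃ Q : FGModuleCat.{u} A, Module.Projective A Q ∧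
    ∃ (a : M →ₗ[A] Q) (b : Q →ₗ[A] N), f.hom.hom - g.hom.hom = b ∘ₗ a

/-- The homomorphisms factoring through finitely generated projectives form an ideal, so the
relation above is a congruence: hom-sets of the quotient category are exactly the quotient
groups. -/
instance : Congruence (projRel A) where
  equivalence := by
    intro X Y
    refine ⟨fun f => ?_, ?_, ?_⟩
    · exact ⟨FGModuleCat.of A PUnit, inferInstance, 0, 0, by simp⟩
    · rintro f g ⟨Q, hQ, a, b, h⟩
      exact ⟨Q, hQ, a, -b, by rw [← neg_sub, h, LinearMap.neg_comp]⟩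
    · rintro f g k ⟨Q, hQ, a, b, h⟩ ⟨Q', hQ', a', b', h'⟩
      refine ⟨FGModuleCat.of A (Q × Q'), inferInstanceAs (Module.Projective A (Q × Q')),
        a.prod a', b.coprod b', ?_⟩
      rw [← sub_add_sub_cancel _ g.hom.hom, h, h']
      ext x
      simp
  comp_left := by
    rintro X Y Z f g g' ⟨Q, hQ, a, b, h⟩
    refine ⟨Q, hQ, a ∘ₗ f.hom.hom, b, ?_⟩
    rw [← LinearMap.comp_assoc, ← h, LinearMap.sub_comp]
    rfl
  comp_right := by
    rintro X Y Z f f' g ⟨Q, hQ, a, b, h⟩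
    refine ⟨Q, hQ, a, g.hom.hom ∘ₗ b, ?_⟩
    rw [LinearMap.comp_assoc, ← h, LinearMap.comp_sub]
    rfl

/-- The stable category of finitely generated `A`-modules. -/
abbrev StableCat := Quotient (projRel A)

/-- The projection of `mod A` to its stable category. -/
abbrev toStable : FGModuleCat.{u} A ⥤ StableCat A := CategoryTheory.Quotient.functor (projRel A)

variable {A}

/-- The objects of the stable category which lie in a given subcategory of `mod A`. -/
def stableProp (X : ObjectProperty (FGModuleCat.{u} A)) : ObjectProperty (StableCat A) :=
  fun M => X M.as

/-- The stable category of a full subcategory of `mod A`, as a full subcategory of the stable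
category of `mod A`. -/
abbrev Stable (X : ObjectProperty (FGModuleCat.{u} A)) := (stableProp X).FullSubcategory

/-- The inclusion of the stable category of a subcategory in the stable category of `mod A`. -/
abbrev stableIncl (X : ObjectProperty (FGModuleCat.{u} A)) : Stable X ⥤ StableCat A :=
  (stableProp X).ι

end Stable

/-! ### Syzygies -/

section Syzygy

variable {A : Type u} [Ring A]

/-- The number of generators used in the chosen free cover of a finitely generated module. -/
def coverRank (M : FGModuleCat.{u} A) : ℕ := (Module.Finite.exists_fin' A M).choose

/-- The chosen finitely generated free module mapping onto `M`. -/
abbrev Cover (M : FGModuleCat.{u} A) : Type u := Fin (coverRank M) → A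

/-- The chosen surjection from a finitely generated free module onto `M`. -/
def cover (M : FGModuleCat.{u} A) : Cover M →ₗ[A] M :=
  (Module.Finite.exists_fin' A M).choose_spec.choose

lemma cover_surjective (M : FGModuleCat.{u} A) : Function.Surjective (cover M) :=
  (Module.Finite.exists_fin' A M).choose_spec.choose_spec

lemma exists_lift {P : Type u} [AddCommGroup P] [Module A P] [Module.Projective A P]
    (N : FGModuleCat.{u} A) (f : P →ₗ[A] N) : ∃ h : P →ₗ[A] Cover N, cover N ∘ₗ h = f :=
  Module.projective_lifting_property _ _ (cover_surjective N)

/-- A chosen lift of `f : M ⟶ N` to the free covers. -/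
def coverMap {M N : FGModuleCat.{u} A} (f : M ⟶ N) : Cover M →ₗ[A] Cover N :=
  (exists_lift N (f.hom.hom ∘ₗ cover M)).choose

lemma coverMap_spec {M N : FGModuleCat.{u} A} (f : M ⟶ N) :
    cover N ∘ₗ coverMap f = f.hom.hom ∘ₗ cover M :=
  (exists_lift N (f.hom.hom ∘ₗ cover M)).choose_spec

variable [IsNoetherianRing A]

/-- The syzygy of `M`: the kernel of the chosen cover, that is, the image of `P₁ → P₀` in a
presentation `P₁ → P₀ → M → 0`. -/
def syz (M : FGModuleCat.{u} A) : FGModuleCat.{u} A :=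
  FGModuleCat.of A (LinearMap.ker (cover M))

/-- The inclusion of the syzygy in the free cover. -/
def syzIncl (M : FGModuleCat.{u} A) : syz M →ₗ[A] Cover M := (LinearMap.ker (cover M)).subtype

lemma cover_comp_syzIncl (M : FGModuleCat.{u} A) : cover M ∘ₗ syzIncl M = 0 := by
  ext x; exact x.2

lemma syzIncl_injective (M : FGModuleCat.{u} A) : Function.Injective (syzIncl M) :=
  Subtype.val_injective

lemma exists_syz_lift {P : Type u} [AddCommGroup P] [Module A P] (N : FGModuleCat.{u} A)
    (h : P →ₗ[A] Cover N) (hh : cover N ∘ₗ h = 0) : ∃ g : P →ₗ[A] syz N, syzIncl N ∘ₗ g = h :=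
  ⟨LinearMap.codRestrict _ h fun x => LinearMap.congr_fun hh x, by ext; rfl⟩

/-- `g : ΩM ⟶ ΩN` is induced by some lift of `f : M ⟶ N` to the free covers. -/
def IsSyzMap {M N : FGModuleCat.{u} A} (f : M →ₗ[A] N) (g : syz M →ₗ[A] syz N) : Prop :=
  ∃ h : Cover M →ₗ[A] Cover N, cover N ∘ₗ h = f ∘ₗ cover M ∧
    syzIncl N ∘ₗ g = h ∘ₗ syzIncl M

lemma exists_isSyzMap {M N : FGModuleCat.{u} A} (f : M ⟶ N) :
    ∃ g : syz M →ₗ[A] syz N, syzIncl N ∘ₗ g = coverMap f ∘ₗ syzIncl M := by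
  apply exists_syz_lift
  rw [← LinearMap.comp_assoc, coverMap_spec, LinearMap.comp_assoc, cover_comp_syzIncl,
    LinearMap.comp_zero]

/-- The homomorphism of syzygies induced by the chosen lift of `f`. -/
def syzMap {M N : FGModuleCat.{u} A} (f : M ⟶ N) : syz M ⟶ syz N :=
  FGModuleCat.ofHom (exists_isSyzMap f).choose

lemma syzMap_spec {M N : FGModuleCat.{u} A} (f : M ⟶ N) :
    syzIncl N ∘ₗ (syzMap f).hom.hom = coverMap f ∘ₗ syzIncl M :=
  (exists_isSyzMap f).choose_spec

lemma isSyzMap_syzMap {M N : FGModuleCat.{u} A} (f : M ⟶ N) :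
    IsSyzMap f.hom.hom (syzMap f).hom.hom :=
  ⟨coverMap f, coverMap_spec f, syzMap_spec f⟩

lemma IsSyzMap.sub {M N : FGModuleCat.{u} A} {f f' : M →ₗ[A] N} {g g' : syz M →ₗ[A] syz N}
    (H : IsSyzMap f g) (H' : IsSyzMap f' g') : IsSyzMap (f - f') (g - g') := by
  obtain ⟨h, h1, h2⟩ := H
  obtain ⟨h', h1', h2'⟩ := H'
  exact ⟨h - h', by rw [LinearMap.comp_sub, LinearMap.sub_comp, h1, h1'],
    by rw [LinearMap.comp_sub, LinearMap.sub_comp, h2, h2']⟩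

lemma IsSyzMap.id (M : FGModuleCat.{u} A) :
    IsSyzMap (M := M) (N := M) LinearMap.id LinearMap.id :=
  ⟨LinearMap.id, rfl, rfl⟩

lemma IsSyzMap.comp {L M N : FGModuleCat.{u} A} {f : M →ₗ[A] N} {f' : L →ₗ[A] M}
    {g : syz M →ₗ[A] syz N} {g' : syz L →ₗ[A] syz M}
    (H : IsSyzMap f g) (H' : IsSyzMap f' g') : IsSyzMap (f ∘ₗ f') (g ∘ₗ g') := by
  obtain ⟨h, h1, h2⟩ := H
  obtain ⟨h', h1', h2'⟩ := H'
  refine ⟨h ∘ₗ h', ?_, ?_⟩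
  · rw [← LinearMap.comp_assoc, h1, LinearMap.comp_assoc, h1', LinearMap.comp_assoc]
  · rw [← LinearMap.comp_assoc, h2, LinearMap.comp_assoc, h2', LinearMap.comp_assoc]

/-- Stably equal homomorphisms induce stably equal homomorphisms of syzygies, whatever the
lifts. -/
lemma projRel_of_isSyzMap {M N : FGModuleCat.{u} A} {f f' : M ⟶ N} {g g' : syz M ⟶ syz N}
    (H : IsSyzMap f.hom.hom g.hom.hom) (H' : IsSyzMap f'.hom.hom g'.hom.hom)
    (hf : projRel A f f') : projRel A g g' := by
  obtain ⟨Q, hQ, a, b, hab⟩ := hf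
  obtain ⟨h, h1, h2⟩ := H.sub H'
  obtain ⟨c, hc⟩ := exists_lift N b
  obtain ⟨k, hk⟩ := exists_syz_lift N (h - c ∘ₗ a ∘ₗ cover M) (by
    rw [LinearMap.comp_sub, h1, hab, ← LinearMap.comp_assoc, hc, LinearMap.comp_assoc, sub_self])
  refine ⟨FGModuleCat.of A (Cover M), inferInstanceAs (Module.Projective A (Cover M)),
    syzIncl M, k, ?_⟩
  apply LinearMap.ext
  intro x
  apply syzIncl_injective
  have e1 := LinearMap.congr_fun h2 x
  have e2 := LinearMap.congr_fun hk (syzIncl M x)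
  have e3 := LinearMap.congr_fun (cover_comp_syzIncl M) x
  simp only [LinearMap.comp_apply, LinearMap.sub_apply, LinearMap.zero_apply] at e1 e2 e3 ⊢
  rw [e2, e3, map_zero, map_zero, sub_zero, ← e1]

variable (A)

/-- The syzygy functor on the stable category. -/
def syzFunctor : StableCat A ⥤ StableCat A :=
  CategoryTheory.Quotient.lift (projRel A)
    { obj := fun M => (CategoryTheory.Quotient.functor (projRel A)).obj (syz M)
      map := fun f => (CategoryTheory.Quotient.functor (projRel A)).map (syzMap f)
      map_id := fun M => by
        rw [← (CategoryTheory.Quotient.functor (projRel A)).map_id]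
        exact CategoryTheory.Quotient.sound _ (projRel_of_isSyzMap (isSyzMap_syzMap _) (IsSyzMap.id M)
          (Congruence.equivalence.refl _))
      map_comp := fun f g => by
        rw [← (CategoryTheory.Quotient.functor (projRel A)).map_comp]
        exact CategoryTheory.Quotient.sound _ (projRel_of_isSyzMap (isSyzMap_syzMap _)
          ((isSyzMap_syzMap g).comp (isSyzMap_syzMap f))
          (Congruence.equivalence.refl _)) }
    (fun _ _ _ _ h => CategoryTheory.Quotient.sound _
      (projRel_of_isSyzMap (isSyzMap_syzMap _) (isSyzMap_syzMap _) h))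

/-- The `n`-th iterate `Ωⁿ` of the syzygy functor on the stable category. -/
def syzPow : ℕ → (StableCat A ⥤ StableCat A)
  | 0 => 𝟭 _
  | n + 1 => syzPow n ⋙ syzFunctor A

variable {A}

/-- The `n`-th syzygy `Ωⁿ M` of a module. -/
def nsyz : ℕ → FGModuleCat.{u} A → FGModuleCat.{u} A
  | 0, M => M
  | n + 1, M => syz (nsyz n M)

end Syzygy

/-! ### The transpose

Throughout, `A` and `B` are rings and `D` is an `A`-`B`-bimodule, in the sense of two commuting
left actions. For a ring `R`, the categories of right and left `R`-modules are those of modules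
over `Rᵐᵒᵖ` and `R`, and the definitions are applied with `D = R` and with `(A, B)` equal
to `(Rᵐᵒᵖ, R)` or `(R, Rᵐᵒᵖ)`. -/

section Dual

variable {A : Type u} [Ring A] (B : Type u) [Ring B] (D : Type u) [AddCommGroup D] [Module A D]
  [Module B D] [SMulCommClass A B D]

/-- The `B`-linear map `Hom(f, D) : Hom_A(N, D) → Hom_A(M, D)`. -/
def dualMap {M N : Type u} [AddCommGroup M] [Module A M] [AddCommGroup N] [Module A N]
    (f : M →ₗ[A] N) : (N →ₗ[A] D) →ₗ[B] (M →ₗ[A] D) where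
  toFun φ := φ ∘ₗ f
  map_add' _ _ := rfl
  map_smul' _ _ := rfl

/-- The `B`-module `Hom_A(Aⁿ, D)` is `Dⁿ`. -/
def dualFree (n : ℕ) : ((Fin n → A) →ₗ[A] D) ≃ₗ[B] (Fin n → D) where
  toFun φ i := φ (Pi.single i 1)
  map_add' _ _ := rfl
  map_smul' _ _ := rfl
  invFun v := ∑ i, (LinearMap.toSpanSingleton A D (v i)) ∘ₗ LinearMap.proj i
  left_inv φ := by
    ext i
    simp [Pi.single_apply]
  right_inv v := by
    ext i
    simp [Pi.single_apply]

lemma dualFree_projective [Module.Projective B D] (n : ℕ) :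
    Module.Projective B ((Fin n → A) →ₗ[A] D) :=
  haveI : Module.Projective B (Fin n → D) :=
    Module.Projective.of_equiv (DFinsupp.linearEquivFunOnFintype (R := B) (M := fun _ : Fin n => D))
  Module.Projective.of_equiv (dualFree B D n).symm

lemma dualFree_finite [Module.Finite B D] (n : ℕ) :
    Module.Finite B ((Fin n → A) →ₗ[A] D) :=
  Module.Finite.equiv (dualFree B D n).symm

end Dual

section Transpose

variable {A : Type u} [Ring A] [IsNoetherianRing A]
  (B : Type u) [Ring B] (D : Type u) [AddCommGroup D] [Module A D] [Module B D]
  [SMulCommClass A B D]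

/-- The map `P₁ → P₀` of the chosen free presentation `P₁ → P₀ → M → 0`. -/
def presMap (M : FGModuleCat.{u} A) : Cover (syz M) →ₗ[A] Cover M := syzIncl M ∘ₗ cover (syz M)

lemma cover_comp_presMap (M : FGModuleCat.{u} A) : cover M ∘ₗ presMap M = 0 := by
  rw [presMap, ← LinearMap.comp_assoc, cover_comp_syzIncl, LinearMap.zero_comp]

lemma exists_presLift {P : Type u} [AddCommGroup P] [Module A P] [Module.Projective A P]
    (N : FGModuleCat.{u} A) (h : P →ₗ[A] Cover N) (hh : cover N ∘ₗ h = 0) :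
    ∃ k : P →ₗ[A] Cover (syz N), presMap N ∘ₗ k = h := by
  obtain ⟨g, hg⟩ := exists_syz_lift N h hh
  obtain ⟨k, hk⟩ := exists_lift (syz N) g
  exact ⟨k, by rw [presMap, LinearMap.comp_assoc, hk, hg]⟩

/-- The underlying module of the transpose: the cokernel of `Hom(P₀, D) → Hom(P₁, D)`. -/
abbrev TrCarrier (M : FGModuleCat.{u} A) : Type u :=
  (Cover (syz M) →ₗ[A] D) ⧸ LinearMap.range (dualMap B D (presMap M))

/-- The projection of `Hom(P₁, D)` onto the transpose. -/
def trProj (M : FGModuleCat.{u} A) : (Cover (syz M) →ₗ[A] D) →ₗ[B] TrCarrier B D M :=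
  (LinearMap.range (dualMap B D (presMap M))).mkQ

lemma trProj_eq_zero (M : FGModuleCat.{u} A) (φ : Cover M →ₗ[A] D) :
    trProj B D M (φ ∘ₗ presMap M) = 0 :=
  (Submodule.Quotient.mk_eq_zero _).2 ⟨φ, rfl⟩

lemma trProj_comp_dualMap (M : FGModuleCat.{u} A) :
    trProj B D M ∘ₗ dualMap B D (presMap M) = 0 := by
  ext φ; exact trProj_eq_zero B D M φ

lemma exists_trLift {X : Type u} [AddCommGroup X] [Module B X] (M : FGModuleCat.{u} A)
    (h : (Cover (syz M) →ₗ[A] D) →ₗ[B] X) (hh : h ∘ₗ dualMap B D (presMap M) = 0) :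
    ∃ t : TrCarrier B D M →ₗ[B] X, t ∘ₗ trProj B D M = h :=
  ⟨Submodule.liftQ _ h (by rw [LinearMap.range_le_ker_iff]; exact hh), by ext; rfl⟩

lemma tr_ext {X : Type u} [AddCommGroup X] [Module B X] {M : FGModuleCat.{u} A}
    {s t : TrCarrier B D M →ₗ[B] X} (h : s ∘ₗ trProj B D M = t ∘ₗ trProj B D M) : s = t :=
  Submodule.linearMap_qext _ h

/-- `t : Tr N → Tr M` is induced by some morphism of presentations lifting `f : M → N`. -/
def IsTrMap {M N : FGModuleCat.{u} A} (f : M →ₗ[A] N)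
    (t : TrCarrier B D N →ₗ[B] TrCarrier B D M) : Prop :=
  ∃ (h₀ : Cover M →ₗ[A] Cover N) (h₁ : Cover (syz M) →ₗ[A] Cover (syz N)),
    cover N ∘ₗ h₀ = f ∘ₗ cover M ∧ presMap N ∘ₗ h₁ = h₀ ∘ₗ presMap M ∧
      t ∘ₗ trProj B D N = trProj B D M ∘ₗ dualMap B D h₁

lemma exists_trMap {M N : FGModuleCat.{u} A} (f : M ⟶ N) :
    ∃ t : TrCarrier B D N →ₗ[B] TrCarrier B D M,
      t ∘ₗ trProj B D N = trProj B D M ∘ₗ dualMap B D (coverMap (syzMap f)) := by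
  apply exists_trLift
  have h : presMap N ∘ₗ coverMap (syzMap f) = coverMap f ∘ₗ presMap M := by
    rw [presMap, LinearMap.comp_assoc, coverMap_spec, ← LinearMap.comp_assoc, syzMap_spec,
      LinearMap.comp_assoc, presMap]
  ext φ
  change trProj B D M ((φ ∘ₗ presMap N) ∘ₗ coverMap (syzMap f)) = 0
  rw [LinearMap.comp_assoc, h, ← LinearMap.comp_assoc, trProj_eq_zero]

/-- The chosen homomorphism `Tr N → Tr M` induced by `f : M ⟶ N`. -/
def trMap {M N : FGModuleCat.{u} A} (f : M ⟶ N) : TrCarrier B D N →ₗ[B] TrCarrier B D M :=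
  (exists_trMap B D f).choose

lemma isTrMap_trMap {M N : FGModuleCat.{u} A} (f : M ⟶ N) :
    IsTrMap B D f.hom.hom (trMap B D f) := by
  refine ⟨coverMap f, coverMap (syzMap f), coverMap_spec f, ?_, (exists_trMap B D f).choose_spec⟩
  rw [presMap, LinearMap.comp_assoc, coverMap_spec, ← LinearMap.comp_assoc, syzMap_spec,
      LinearMap.comp_assoc, presMap]

variable {B D}

lemma IsTrMap.id (M : FGModuleCat.{u} A) : IsTrMap B D (M := M) (N := M) LinearMap.id
    LinearMap.id :=
  ⟨LinearMap.id, LinearMap.id, rfl, rfl, rfl⟩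

lemma IsTrMap.comp {L M N : FGModuleCat.{u} A} {f : M →ₗ[A] N} {f' : L →ₗ[A] M}
    {t : TrCarrier B D N →ₗ[B] TrCarrier B D M} {t' : TrCarrier B D M →ₗ[B] TrCarrier B D L}
    (H : IsTrMap B D f t) (H' : IsTrMap B D f' t') : IsTrMap B D (f ∘ₗ f') (t' ∘ₗ t) := by
  obtain ⟨h₀, h₁, e0, e1, e2⟩ := H
  obtain ⟨h₀', h₁', e0', e1', e2'⟩ := H'
  refine ⟨h₀ ∘ₗ h₀', h₁ ∘ₗ h₁', ?_, ?_, ?_⟩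
  · rw [← LinearMap.comp_assoc, e0, LinearMap.comp_assoc, e0', LinearMap.comp_assoc]
  · rw [← LinearMap.comp_assoc, e1, LinearMap.comp_assoc, e1', LinearMap.comp_assoc]
  · rw [LinearMap.comp_assoc, e2, ← LinearMap.comp_assoc, e2', LinearMap.comp_assoc]
    rfl

lemma IsTrMap.sub {M N : FGModuleCat.{u} A} {f f' : M →ₗ[A] N}
    {t t' : TrCarrier B D N →ₗ[B] TrCarrier B D M}
    (H : IsTrMap B D f t) (H' : IsTrMap B D f' t') : IsTrMap B D (f - f') (t - t') := by
  obtain ⟨h₀, h₁, e0, e1, e2⟩ := H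
  obtain ⟨h₀', h₁', e0', e1', e2'⟩ := H'
  refine ⟨h₀ - h₀', h₁ - h₁', by rw [LinearMap.comp_sub, LinearMap.sub_comp, e0, e0'],
    by rw [LinearMap.comp_sub, LinearMap.sub_comp, e1, e1'], ?_⟩
  rw [LinearMap.sub_comp, e2, e2', ← LinearMap.comp_sub]
  congr 1
  ext φ : 1
  exact (LinearMap.comp_sub h₁' h₁ φ).symm

lemma IsTrMap.factors {M N : FGModuleCat.{u} A} {f : M →ₗ[A] N}
    {t : TrCarrier B D N →ₗ[B] TrCarrier B D M} (H : IsTrMap B D f t)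
    {Q : Type u} [AddCommGroup Q] [Module A Q] [Module.Projective A Q]
    (a : M →ₗ[A] Q) (b : Q →ₗ[A] N) (hab : f = b ∘ₗ a) :
    ∃ c : TrCarrier B D N →ₗ[B] (Cover (syz M) →ₗ[A] D), t = trProj B D M ∘ₗ c := by
  obtain ⟨h₀, h₁, e0, e1, e2⟩ := H
  obtain ⟨c, hc⟩ := exists_lift N b
  obtain ⟨k, hk⟩ := exists_presLift N (h₀ - c ∘ₗ a ∘ₗ cover M) (by
    rw [LinearMap.comp_sub, e0, hab, ← LinearMap.comp_assoc, hc, LinearMap.comp_assoc, sub_self])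
  have e3 : presMap N ∘ₗ (h₁ - k ∘ₗ presMap M) = 0 := by
    rw [LinearMap.comp_sub, ← LinearMap.comp_assoc, hk, e1, LinearMap.sub_comp,
      LinearMap.comp_assoc, LinearMap.comp_assoc, cover_comp_presMap, LinearMap.comp_zero,
      LinearMap.comp_zero, sub_zero, sub_self]
  obtain ⟨d, hd⟩ := exists_trLift B D N (dualMap B D (h₁ - k ∘ₗ presMap M)) (by
    ext φ : 1
    change (φ ∘ₗ presMap N) ∘ₗ (h₁ - k ∘ₗ presMap M) = 0
    rw [LinearMap.comp_assoc, e3, LinearMap.comp_zero])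
  refine ⟨d, tr_ext B D ?_⟩
  rw [e2, LinearMap.comp_assoc, hd]
  ext φ
  change trProj B D M (φ ∘ₗ h₁) = trProj B D M (φ ∘ₗ (h₁ - k ∘ₗ presMap M))
  rw [LinearMap.comp_sub, map_sub, ← LinearMap.comp_assoc, trProj_eq_zero, sub_zero]

variable (B D) [Module.Finite B D]

/-- The (Auslander) transpose of a finitely generated `A`-module. -/
def tr (M : FGModuleCat.{u} A) : FGModuleCat.{u} B :=
  haveI := dualFree_finite (A := A) B D (coverRank (syz M))
  FGModuleCat.of B (TrCarrier B D M)

variable {B D}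

/-- Stably equal homomorphisms induce stably equal homomorphisms of transposes, whatever the
lifts. -/
lemma projRel_of_isTrMap [Module.Projective B D] {M N : FGModuleCat.{u} A} {f f' : M ⟶ N}
    {t t' : tr B D N ⟶ tr B D M}
    (H : IsTrMap B D f.hom.hom t.hom.hom) (H' : IsTrMap B D f'.hom.hom t'.hom.hom)
    (hf : projRel A f f') : projRel B t t' := by
  obtain ⟨Q, hQ, a, b, hab⟩ := hf
  obtain ⟨c, hc⟩ := (H.sub H').factors a b hab
  have := dualFree_finite (A := A) B D (coverRank (syz M))
  exact ⟨FGModuleCat.of B (Cover (syz M) →ₗ[A] D),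
    dualFree_projective (A := A) B D (coverRank (syz M)), c, trProj B D M, hc⟩

/-- `trMap` as a morphism of finitely generated modules. -/
def trHom {M N : FGModuleCat.{u} A} (f : M ⟶ N) : tr B D N ⟶ tr B D M :=
  ObjectProperty.homMk (ModuleCat.ofHom (trMap B D f))

variable (A B D)

/-- The transpose as a contravariant functor between stable categories. -/
def trFunctor [Module.Projective B D] : (StableCat A)ᵒᵖ ⥤ StableCat B :=
  Functor.leftOp <| CategoryTheory.Quotient.lift (projRel A)
    { obj := fun M => Opposite.op ((CategoryTheory.Quotient.functor (projRel B)).obj (tr B D M))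
      map := fun f => ((CategoryTheory.Quotient.functor (projRel B)).map (trHom f)).op
      map_id := fun M => by
        rw [← op_id, ← (CategoryTheory.Quotient.functor (projRel B)).map_id]
        congr 1
        exact CategoryTheory.Quotient.sound _ (projRel_of_isTrMap (isTrMap_trMap B D (𝟙 M)) (IsTrMap.id M)
          (Congruence.equivalence.refl _))
      map_comp := fun f g => by
        rw [← op_comp, ← (CategoryTheory.Quotient.functor (projRel B)).map_comp]
        congr 1
        exact CategoryTheory.Quotient.sound _ (projRel_of_isTrMap (isTrMap_trMap B D (f ≫ g))
          ((isTrMap_trMap B D g).comp (isTrMap_trMap B D f))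
          (Congruence.equivalence.refl _)) }
    (fun _ _ f g h => congrArg Quiver.Hom.op (CategoryTheory.Quotient.sound _
      (projRel_of_isTrMap (isTrMap_trMap B D f) (isTrMap_trMap B D g) h)))

/-- The contravariant functor `Tr Ωⁿ` between stable categories. -/
def trSyz [Module.Projective B D] (n : ℕ) : (StableCat A)ᵒᵖ ⥤ StableCat B :=
  (syzPow A n).op ⋙ trFunctor A B D

end Transpose

/-! ### Ext with values in the bimodule -/

section Ext

open CategoryTheory.Abelian

variable (A : Type u) [Ring A] (B : Type u) [Ring B]
  (D : Type u) [AddCommGroup D] [Module A D] [Module B D] [SMulCommClass A B D]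

/-- `Extⁱ_A(M, D) = 0`. -/
def ExtVanishes (M : ModuleCat.{u} A) (i : ℕ) : Prop :=
  Subsingleton (Ext.{u} M (ModuleCat.of A D) i)

variable {B} in
/-- The action of `b : B` on `D`, as an endomorphism in the category of `A`-modules. -/
def actB (b : B) : ModuleCat.of A D ⟶ ModuleCat.of A D :=
  ModuleCat.ofHom
    { toFun := fun x => b • x
      map_add' := fun x y => smul_add b x y
      map_smul' := fun a x => (smul_comm a b x).symm }

/-- The `B`-module structure of `Extⁿ_A(M, D)`, induced by functoriality from the action
on `D`. -/
abbrev extModule (M : ModuleCat.{u} A) (n : ℕ) : Module B (Ext.{u} M (ModuleCat.of A D) n) where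
  smul b x := x.comp (Ext.mk₀ (actB A D b)) (add_zero n)
  one_smul x := by
    change x.comp (Ext.mk₀ (actB A D (1 : B))) (add_zero n) = x
    have : actB A D (1 : B) = 𝟙 _ := by ext d; exact one_smul B d
    rw [this, Ext.comp_mk₀_id]
  mul_smul b c x := by
    change x.comp (Ext.mk₀ (actB A D (b * c))) (add_zero n) =
      (x.comp (Ext.mk₀ (actB A D c)) (add_zero n)).comp (Ext.mk₀ (actB A D b)) (add_zero n)
    have : actB A D (b * c) = actB A D c ≫ actB A D b := by ext d; exact mul_smul b c d
    rw [this, Ext.comp_assoc_of_third_deg_zero, Ext.mk₀_comp_mk₀]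
  smul_zero b := Ext.zero_comp (n := n) _ (Ext.mk₀ (actB A D b)) n (add_zero n)
  smul_add b x y := Ext.add_comp x y (Ext.mk₀ (actB A D b)) (add_zero n)
  add_smul b c x := by
    change x.comp (Ext.mk₀ (actB A D (b + c))) (add_zero n) =
      x.comp (Ext.mk₀ (actB A D b)) (add_zero n) + x.comp (Ext.mk₀ (actB A D c)) (add_zero n)
    have : actB A D (b + c) = actB A D b + actB A D c := by ext d; exact add_smul b c d
    rw [this, Ext.mk₀_add, Ext.comp_add]
  zero_smul x := by
    change x.comp (Ext.mk₀ (actB A D (0 : B))) (add_zero n) = 0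
    have : actB A D (0 : B) = 0 := by ext d; exact zero_smul B d
    rw [this, Ext.mk₀_zero, Ext.comp_zero]

/-- The `B`-module `Extⁿ_A(M, D)`. -/
def extObj (n : ℕ) (M : ModuleCat.{u} A) : ModuleCat.{u} B :=
  letI := extModule A B D M n
  ModuleCat.of B (Ext.{u} M (ModuleCat.of A D) n)

/-- The `B`-linear map `Extⁿ_A(f, D)`. -/
def extMap (n : ℕ) {M N : ModuleCat.{u} A} (f : M ⟶ N) : extObj A B D n N ⟶ extObj A B D n M :=
  letI := extModule A B D M n
  letI := extModule A B D N n
  ModuleCat.ofHom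
    { toFun := fun x : Ext.{u} N (ModuleCat.of A D) n => (Ext.mk₀ f).comp x (zero_add n)
      map_add' := fun _ _ => Ext.comp_add _ _ _ _
      map_smul' := fun _ _ => (Ext.comp_assoc_of_third_deg_zero _ _ _ _).symm }

/-- The contravariant functor `Extⁿ_A(-, D)` from `A`-modules to `B`-modules. -/
def extFunctor (n : ℕ) : (ModuleCat.{u} A)ᵒᵖ ⥤ ModuleCat.{u} B where
  obj M := extObj A B D n M.unop
  map f := extMap A B D n f.unop
  map_id M := ModuleCat.hom_ext (LinearMap.ext fun x =>
    Ext.mk₀_id_comp (X := M.unop) (Y := ModuleCat.of A D) (n := n) x)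
  map_comp f g := ModuleCat.hom_ext (LinearMap.ext fun x =>
    (Ext.mk₀_comp_mk₀_assoc g.unop f.unop (T := ModuleCat.of A D) (n := n) x).symm)

lemma extMap_eq_of_projRel {n : ℕ} (hn : 1 ≤ n) {M N : FGModuleCat.{u} A} {f g : M ⟶ N}
    (h : projRel A f g) : extMap A B D n f.hom = extMap A B D n g.hom := by
  obtain ⟨Q, hQ, a, b, hab⟩ := h
  obtain ⟨k, rfl⟩ : ∃ k, n = k + 1 := ⟨n - 1, by omega⟩
  have hfg : f.hom = g.hom + ModuleCat.ofHom a ≫ ModuleCat.ofHom b :=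
    ModuleCat.hom_ext (eq_add_of_sub_eq' hab)
  have : Projective (ModuleCat.of A Q) := (IsProjective.iff_projective Q).1 hQ
  refine ModuleCat.hom_ext (LinearMap.ext fun x => ?_)
  let x' : Ext.{u} N.obj (ModuleCat.of A D) (k + 1) := x
  change (Ext.mk₀ f.hom).comp x' (zero_add _) = (Ext.mk₀ g.hom).comp x' (zero_add _)
  rw [hfg, Ext.mk₀_add, Ext.add_comp, ← Ext.mk₀_comp_mk₀_assoc,
    Ext.eq_zero_of_projective ((Ext.mk₀ (ModuleCat.ofHom b)).comp x' (zero_add _)),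
    Ext.comp_zero, add_zero]

/-- For `n ≥ 1`, the contravariant functor `Extⁿ_A(-, D)` on the stable category. -/
def stableExt (n : ℕ) (hn : 1 ≤ n) : (StableCat A)ᵒᵖ ⥤ ModuleCat.{u} B :=
  Functor.leftOp <| CategoryTheory.Quotient.lift (projRel A)
    (((ModuleCat.isFG.{u} A).ι.op ⋙ extFunctor A B D n).rightOp)
    (fun _ _ _ _ h => congrArg Quiver.Hom.op (extMap_eq_of_projRel A B D hn h))

end Ext

/-! ### The subcategories of `mod A` -/

section Subcategories

open CategoryTheory.Abelian

variable (A : Type u) [Ring A]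

/-- The finitely generated projective modules. -/
def projProp : ObjectProperty (FGModuleCat.{u} A) := fun M => Module.Projective A M

/-- The grade of `M`: the infimum of all `i` with `Extⁱ_A(M, D) ≠ 0`
(infinite if there are none). -/
def modGrade (D : Type u) [AddCommGroup D] [Module A D] (M : FGModuleCat.{u} A) : ℕ∞ :=
  ⨅ (i : ℕ) (_ : ¬ ExtVanishes A D M.obj i), (i : ℕ∞)

/-- `Grd_n`: the modules of grade at least `n`. -/
def grdProp (D : Type u) [AddCommGroup D] [Module A D] (n : ℕ) :
    ObjectProperty (FGModuleCat.{u} A) :=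
  fun M => (n : ℕ∞) ≤ modGrade A D M

variable {A} in
/-- `X ∗ Y`: the modules `M` in an exact sequence `0 → L → M → N → 0` with `L` in `X` and `N`
in `Y`. -/
def starProp (X Y : ObjectProperty (FGModuleCat.{u} A)) : ObjectProperty (FGModuleCat.{u} A) :=
  fun M => ∃ (L N : FGModuleCat.{u} A) (f : L →ₗ[A] M) (g : M →ₗ[A] N),
    X L ∧ Y N ∧ Function.Injective f ∧ Function.Exact f g ∧ Function.Surjective g

/-- The modules which are `n`-`X`-spherical: `Extⁱ_A(M, D) = 0` for `1 ≤ i ≤ n - 1`, and `Ωⁿ M`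
lies in `X`. -/
def sphProp [IsNoetherianRing A] (D : Type u) [AddCommGroup D] [Module A D] (n : ℕ)
    (X : ObjectProperty (FGModuleCat.{u} A)) : ObjectProperty (FGModuleCat.{u} A) :=
  fun M => (∀ i : ℕ, 1 ≤ i → i < n → ExtVanishes A D M.obj i) ∧ X (nsyz n M)

variable (B : Type u) [Ring B] (D : Type u) [AddCommGroup D] [Module A D] [Module B D]
  [SMulCommClass A B D]

/-- `𝒢_{m,n}`: the modules `M` with `Extⁱ_A(M, D) = 0` for `1 ≤ i ≤ m` and
`Extʲ_B(Tr M, D) = 0` for `1 ≤ j ≤ n`, where `m` and `n` may be infinite. -/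
def gProp [IsNoetherianRing A] [Module.Finite B D] (m n : ℕ∞) :
    ObjectProperty (FGModuleCat.{u} A) :=
  fun M => (∀ i : ℕ, 1 ≤ i → (i : ℕ∞) ≤ m → ExtVanishes A D M.obj i) ∧
    (∀ j : ℕ, 1 ≤ j → (j : ℕ∞) ≤ n → ExtVanishes B D (tr B D M).obj j)

/-- The totally reflexive (finitely generated Gorenstein projective) modules: the evaluation map
`M → M**` is bijective, and `Extⁱ_A(M, D) = 0 = Extⁱ_B(M*, D)` for all `i ≥ 1`. -/
def totReflProp : ObjectProperty (FGModuleCat.{u} A) := fun M =>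
  Function.Bijective (fun (x : M) => (LinearMap.applyₗ' B x : (M →ₗ[A] D) →ₗ[B] D)) ∧
    (∀ i : ℕ, 1 ≤ i → ExtVanishes A D M.obj i) ∧
    (∀ i : ℕ, 1 ≤ i → ExtVanishes B D (ModuleCat.of B (M →ₗ[A] D)) i)

end Subcategories

/-! ### The regular bimodule -/

section Regular

variable (R : Type u) [Ring R]

instance : Module.Projective Rᵐᵒᵖ R :=
  Module.Projective.of_equiv (MulOpposite.opLinearEquiv Rᵐᵒᵖ (M := R)).symm

instance : Module.Finite Rᵐᵒᵖ R :=
  Module.Finite.equiv (MulOpposite.opLinearEquiv Rᵐᵒᵖ (M := R)).symm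

end Regular

end StableMod

end

open StableMod

noncomputable section

set_option linter.unusedSectionVars false

namespace StableMod

/-! ### Biduality -/

section Bidual

/-! Write n = k + 1 and X* = Hom(X, D). The argument runs for an A-B-bimodule D, finitely generated
projective on both sides, with A = End_B(D) and B = End_A(D) (`IsEndRing`). These conditions are
symmetric in A and B, so one argument serves both directions; D = R at the end.

Tr is a stable duality (`trTrIso`), since finitely generated projectives are reflexive. For a free
resolution P₂ → P₁ → P₀ of X, the map P₁* → P₂* induces `trDelta` : Tr X → P₂*, with kernel Ext¹(X,
D) and cokernel Tr ΩX. This gives a natural stable map Tr X → Ω Tr ΩX (`theta`), invertible when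
Ext¹(X, D) = 0. Iterating, Tr → Ωᵏ Tr Ωᵏ is invertible at X when Extⁱ(X, D) = 0 for 1 ≤ i ≤ k
(`isIso_thetaPow`). Applying Tr gives a natural map Tr Ωᵏ Tr Ωᵏ → 1, invertible at the same modules.
Hence Tr Ωᵏ is a duality between any two subcategories which it exchanges and whose objects satisfy
this vanishing (`trSyzEquiv`).

It remains to see which objects are exchanged. Let Ω Tr exchange X and X', with Ext in degrees 1,
..., n vanishing on X'. If M is n-X-spherical and Y = ΩᵏM, the image Z of `trDelta` is stably Ω Tr
ΩY, so it lies in X'; the kernel L has grade at least n by the long exact sequence and, in degree 0,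
by biduality (`starProp_tr_nsyz`). Conversely, for 0 → L → N → Z → 0 with L of grade at least n and
Z in X', one has Z* = N*. Now Ω Tr N is stably P₀*/N*, so it agrees with Ω Tr Z; and Ωⁿ Tr ΩᵏN
agrees with Ω Tr N by the iterated comparison (`stIso_syz_tr`, `sphProp_tr_nsyz`).

Part 2 is the case of 𝒢_{m,m+1}, which Ω Tr exchanges (`gProp_syz_tr`). Part 3 is its case m = ∞, by
Auslander's sequence 0 → Ext¹(Tr X, D) → X → X** → Ext²(Tr X, D) → 0. Part 1 starts from X = X' =
proj. There Grd_n maps to the stable category of Grd_n ∗ proj fully faithfully, a module with zero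
dual having no nonzero map to a projective, and essentially surjectively, because Extⁿ(M, D) is
stably Tr ΩᵏM when ΩⁿM is projective (`extTrans`). -/

/-- The action of `a : A` on `D`, as a `B`-linear map. -/
def smulEnd {A : Type u} [Ring A] (B : Type u) [Ring B] (D : Type u) [AddCommGroup D]
    [Module A D] [Module B D] [SMulCommClass A B D] (a : A) : D →ₗ[B] D where
  toFun x := a • x
  map_add' := smul_add a
  map_smul' b x := smul_comm a b x

/-- The ring `A` is the ring of `B`-linear endomorphisms of `D`. -/
class IsEndRing (A : Type u) [Ring A] (B : Type u) [Ring B] (D : Type u) [AddCommGroup D]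
    [Module A D] [Module B D] [SMulCommClass A B D] : Prop where
  bijective : Function.Bijective (smulEnd (A := A) B D)

variable {A : Type u} [Ring A] (B : Type u) [Ring B] (D : Type u) [AddCommGroup D] [Module A D]
  [Module B D] [SMulCommClass A B D]

lemma dualMap_comp {P Q S : Type u} [AddCommGroup P] [Module A P] [AddCommGroup Q] [Module A Q]
    [AddCommGroup S] [Module A S] (g : Q →ₗ[A] S) (f : P →ₗ[A] Q) :
    dualMap B D (g ∘ₗ f) = dualMap B D f ∘ₗ dualMap B D g := rfl

lemma dualMap_sub {P Q : Type u} [AddCommGroup P] [Module A P] [AddCommGroup Q] [Module A Q]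
    (f g : P →ₗ[A] Q) : dualMap B D (f - g) = dualMap B D f - dualMap B D g := by
  ext φ x
  exact map_sub φ _ _

lemma dualMap_zero {P Q : Type u} [AddCommGroup P] [Module A P] [AddCommGroup Q] [Module A Q] :
    dualMap B D (0 : P →ₗ[A] Q) = 0 := by
  ext φ x
  exact map_zero φ

variable [SMulCommClass B A D]

variable (A) in
/-- The evaluation map from a module to its bidual. -/
def evMap (P : Type u) [AddCommGroup P] [Module A P] : P →ₗ[A] ((P →ₗ[A] D) →ₗ[B] D) where
  toFun x := LinearMap.applyₗ' B x
  map_add' x y := by ext φ; exact map_add φ x y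
  map_smul' a x := by ext φ; exact map_smul φ a x

@[simp] lemma evMap_apply {P : Type u} [AddCommGroup P] [Module A P] (x : P) (φ : P →ₗ[A] D) :
    evMap A B D P x φ = φ x := rfl

lemma evMap_natural {P Q : Type u} [AddCommGroup P] [Module A P] [AddCommGroup Q] [Module A Q]
    (f : P →ₗ[A] Q) :
    evMap A B D Q ∘ₗ f = dualMap A D (dualMap B D f) ∘ₗ evMap A B D P := rfl

lemma evMap_bijective_of_retract {P Q : Type u} [AddCommGroup P] [Module A P] [AddCommGroup Q]
    [Module A Q] (i : P →ₗ[A] Q) (r : Q →ₗ[A] P) (h : r ∘ₗ i = LinearMap.id)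
    (hQ : Function.Bijective (evMap A B D Q)) : Function.Bijective (evMap A B D P) := by
  constructor
  · intro (x : P) (y : P) hxy
    have := LinearMap.congr_fun (evMap_natural B D i)
    have e : evMap A B D Q (i x) = evMap A B D Q (i y) := by
      have hx := this x
      have hy := this y
      simp only [LinearMap.comp_apply] at hx hy
      rw [hx, hy, hxy]
    have := congrArg r (hQ.1 e)
    rwa [← LinearMap.comp_apply, ← LinearMap.comp_apply, h] at this
  · intro ψ
    obtain ⟨q, hq⟩ := hQ.2 (dualMap A D (dualMap B D i) ψ)
    refine ⟨r q, ?_⟩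
    ext φ
    have := LinearMap.congr_fun hq (φ ∘ₗ r)
    change φ (r q) = ψ ((φ ∘ₗ r) ∘ₗ i) at this
    rwa [LinearMap.comp_assoc, h, LinearMap.comp_id] at this

/-- A functional on Hom(Aⁿ, D) ≅ Dⁿ restricts on each coordinate to a B-endomorphism of D, that is,
to an element of A. This is where the defining property of `IsEndRing` enters; the other reflexivity
statements follow by taking retracts. -/
lemma evMap_bijective_free [IsEndRing A B D] (n : ℕ) :
    Function.Bijective (evMap A B D (Fin n → A)) := by
  have hb := IsEndRing.bijective (A := A) (B := B) (D := D)
  constructor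
  · rw [injective_iff_map_eq_zero]
    intro x hx
    ext i
    have : smulEnd (A := A) B D (x i) = smulEnd (A := A) B D 0 := by
      ext v
      have := LinearMap.congr_fun hx (LinearMap.toSpanSingleton A D v ∘ₗ LinearMap.proj i)
      simpa [smulEnd] using this
    exact hb.1 this
  · intro ψ
    choose a ha using fun i : Fin n => hb.2
      (ψ ∘ₗ (dualFree (A := A) B D n).symm.toLinearMap ∘ₗ LinearMap.single B (fun _ => D) i)
    refine ⟨a, ?_⟩
    have key : evMap A B D (Fin n → A) a ∘ₗ (dualFree (A := A) B D n).symm.toLinearMap =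
        ψ ∘ₗ (dualFree (A := A) B D n).symm.toLinearMap := by
      refine LinearMap.pi_ext' fun i => ?_
      rw [LinearMap.comp_assoc, LinearMap.comp_assoc, ← ha i]
      ext v
      change (∑ j, LinearMap.toSpanSingleton A D ((Pi.single i v : Fin n → D) j) ∘ₗ
        LinearMap.proj j) a = a i • v
      simp [LinearMap.sum_apply, Pi.single_apply]
    ext φ
    have := LinearMap.congr_fun key (dualFree (A := A) B D n φ)
    simpa using this

end Bidual

section Projective

variable {A : Type u} [Ring A]

lemma exists_free_retract (P : Type u) [AddCommGroup P] [Module A P] [Module.Finite A P]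
    [Module.Projective A P] : ∃ (n : ℕ) (i : P →ₗ[A] (Fin n → A)) (r : (Fin n → A) →ₗ[A] P),
    r ∘ₗ i = LinearMap.id := by
  obtain ⟨n, r, hr⟩ := Module.Finite.exists_fin' A P
  obtain ⟨i, hi⟩ := Module.projective_lifting_property r LinearMap.id hr
  exact ⟨n, i, r, hi⟩

variable (A) (B : Type u) [Ring B] (D : Type u) [AddCommGroup D] [Module A D]
  [Module B D] [SMulCommClass A B D] (P : Type u) [AddCommGroup P] [Module A P]
  [Module.Finite A P] [Module.Projective A P]

lemma evMap_bijective [SMulCommClass B A D] [IsEndRing A B D] :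
    Function.Bijective (evMap A B D P) := by
  obtain ⟨n, i, r, h⟩ := exists_free_retract (A := A) P
  exact evMap_bijective_of_retract B D i r h (evMap_bijective_free B D n)

/-- The evaluation isomorphism of a finitely generated projective module. -/
def evEquiv [SMulCommClass B A D] [IsEndRing A B D] : P ≃ₗ[A] ((P →ₗ[A] D) →ₗ[B] D) :=
  LinearEquiv.ofBijective (evMap A B D P) (evMap_bijective A B D P)

instance dual_projective [Module.Projective B D] : Module.Projective B (P →ₗ[A] D) := by
  obtain ⟨n, i, r, h⟩ := exists_free_retract (A := A) P
  have := dualFree_projective (A := A) B D n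
  exact Module.Projective.of_split (dualMap B D r) (dualMap B D i) (by
    rw [← dualMap_comp, h]; rfl)

instance dual_finite [Module.Finite B D] : Module.Finite B (P →ₗ[A] D) := by
  obtain ⟨n, i, r, h⟩ := exists_free_retract (A := A) P
  have := dualFree_finite (A := A) B D n
  refine Module.Finite.of_surjective (dualMap B D i) fun φ => ⟨φ ∘ₗ r, ?_⟩
  change (φ ∘ₗ r) ∘ₗ i = φ
  rw [LinearMap.comp_assoc, h, LinearMap.comp_id]

end Projective

/-! ### Homomorphisms of presentations -/

section SyzPres

variable {A : Type u} [Ring A]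

/-- A homomorphism `g` of kernels induced by `f`, for sequences `K → P → N` and
`K' → P' → N'`. -/
def SyzRel {K P N K' P' N' : Type u} [AddCommGroup K] [Module A K] [AddCommGroup P] [Module A P]
    [AddCommGroup N] [Module A N] [AddCommGroup K'] [Module A K'] [AddCommGroup P'] [Module A P']
    [AddCommGroup N'] [Module A N'] (i : K →ₗ[A] P) (π : P →ₗ[A] N) (i' : K' →ₗ[A] P')
    (π' : P' →ₗ[A] N') (f : N →ₗ[A] N') (g : K →ₗ[A] K') : Prop :=
  ∃ h : P →ₗ[A] P', π' ∘ₗ h = f ∘ₗ π ∧ i' ∘ₗ g = h ∘ₗ i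

/-- A short exact sequence `0 → K → P → N → 0`. -/
structure SyzPres {K P N : Type u} [AddCommGroup K] [Module A K] [AddCommGroup P] [Module A P]
    [AddCommGroup N] [Module A N] (i : K →ₗ[A] P) (π : P →ₗ[A] N) : Prop where
  inj : Function.Injective i
  exact : Function.Exact i π
  surj : Function.Surjective π

variable {K P N K' P' N' K'' P'' N'' : Type u} [AddCommGroup K] [Module A K] [AddCommGroup P]
  [Module A P] [AddCommGroup N] [Module A N] [AddCommGroup K'] [Module A K'] [AddCommGroup P']
  [Module A P'] [AddCommGroup N'] [Module A N'] [AddCommGroup K''] [Module A K'']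
  [AddCommGroup P''] [Module A P''] [AddCommGroup N''] [Module A N'']
  {i : K →ₗ[A] P} {π : P →ₗ[A] N} {i' : K' →ₗ[A] P'} {π' : P' →ₗ[A] N'}
  {i'' : K'' →ₗ[A] P''} {π'' : P'' →ₗ[A] N''}

lemma SyzPres.exists_lift (H : SyzPres i π) (h : P' →ₗ[A] P) (hh : π ∘ₗ h = 0) :
    ∃ g : P' →ₗ[A] K, i ∘ₗ g = h := by
  refine ⟨(LinearEquiv.ofInjective i H.inj).symm ∘ₗ
    LinearMap.codRestrict (LinearMap.range i) h fun x => (H.exact _).1 (LinearMap.congr_fun hh x),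
    ?_⟩
  ext x
  exact congrArg Subtype.val ((LinearEquiv.ofInjective i H.inj).apply_symm_apply _)

lemma SyzRel.id : SyzRel i π i π LinearMap.id LinearMap.id := ⟨LinearMap.id, rfl, rfl⟩

lemma SyzRel.comp {f' : N' →ₗ[A] N''} {g' : K' →ₗ[A] K''} {f : N →ₗ[A] N'} {g : K →ₗ[A] K'}
    (H' : SyzRel i' π' i'' π'' f' g') (H : SyzRel i π i' π' f g) :
    SyzRel i π i'' π'' (f' ∘ₗ f) (g' ∘ₗ g) := by
  obtain ⟨h, h1, h2⟩ := H
  obtain ⟨h', h1', h2'⟩ := H'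
  refine ⟨h' ∘ₗ h, ?_, ?_⟩
  · rw [← LinearMap.comp_assoc, h1', LinearMap.comp_assoc, h1, LinearMap.comp_assoc]
  · rw [← LinearMap.comp_assoc, h2', LinearMap.comp_assoc, h2, LinearMap.comp_assoc]

lemma SyzRel.sub {f f' : N →ₗ[A] N'} {g g' : K →ₗ[A] K'} (H : SyzRel i π i' π' f g)
    (H' : SyzRel i π i' π' f' g') : SyzRel i π i' π' (f - f') (g - g') := by
  obtain ⟨h, h1, h2⟩ := H
  obtain ⟨h', h1', h2'⟩ := H'
  exact ⟨h - h', by rw [LinearMap.comp_sub, LinearMap.sub_comp, h1, h1'],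
    by rw [LinearMap.comp_sub, LinearMap.sub_comp, h2, h2']⟩

/-- On the source side a complex suffices; this matters for `trDelta`, which need not be injective.
-/
lemma SyzPres.exists_rel [Module.Projective A P] (hi : π ∘ₗ i = 0) (H' : SyzPres i' π')
    (f : N →ₗ[A] N') : ∃ g, SyzRel i π i' π' f g := by
  obtain ⟨h, hh⟩ := Module.projective_lifting_property π' (f ∘ₗ π) H'.surj
  obtain ⟨g, hg⟩ := H'.exists_lift (h ∘ₗ i) (by
    rw [← LinearMap.comp_assoc, hh, LinearMap.comp_assoc, hi, LinearMap.comp_zero])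
  exact ⟨g, h, hh, hg⟩

/-- A homomorphism of kernels induced by one which factors through a projective module factors
through the inclusion of the kernel. -/
lemma SyzRel.factors {Q : Type u} [AddCommGroup Q] [Module A Q] [Module.Projective A Q]
    (hi : π ∘ₗ i = 0) (H' : SyzPres i' π') {f : N →ₗ[A] N'} {g : K →ₗ[A] K'}
    (H : SyzRel i π i' π' f g) (a : N →ₗ[A] Q) (b : Q →ₗ[A] N') (hab : f = b ∘ₗ a) :
    ∃ k : P →ₗ[A] K', g = k ∘ₗ i := by
  obtain ⟨h, h1, h2⟩ := H
  obtain ⟨c, hc⟩ := Module.projective_lifting_property π' b H'.surj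
  -- Subtracting the part of the lift that passes through Q leaves a map into the kernel of π';
  -- along i nothing changes, as π ∘ i = 0.
  obtain ⟨k, hk⟩ := H'.exists_lift (h - c ∘ₗ a ∘ₗ π) (by
    rw [LinearMap.comp_sub, h1, hab, ← LinearMap.comp_assoc, hc, LinearMap.comp_assoc, sub_self])
  refine ⟨k, (LinearMap.cancel_left H'.inj).1 ?_⟩
  rw [← LinearMap.comp_assoc, hk, h2, LinearMap.sub_comp, LinearMap.comp_assoc,
    LinearMap.comp_assoc, hi, LinearMap.comp_zero, LinearMap.comp_zero, sub_zero]

end SyzPres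

section TrPres

variable {A : Type u} [Ring A] (B : Type u) [Ring B] (D : Type u) [AddCommGroup D] [Module A D]
  [Module B D] [SMulCommClass A B D]

/-- A homomorphism `t` of transposes induced by `f`, for presentations `P₁ → P₀ → X` and
`P₁' → P₀' → X'` and transposes `T` and `T'` computed from them. -/
def TrRel {P₁ P₀ X T P₁' P₀' X' T' : Type u} [AddCommGroup P₁] [Module A P₁] [AddCommGroup P₀]
    [Module A P₀] [AddCommGroup X] [Module A X] [AddCommGroup T] [Module B T] [AddCommGroup P₁']
    [Module A P₁'] [AddCommGroup P₀'] [Module A P₀'] [AddCommGroup X'] [Module A X']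
    [AddCommGroup T'] [Module B T']
    (d : P₁ →ₗ[A] P₀) (π : P₀ →ₗ[A] X) (p : (P₁ →ₗ[A] D) →ₗ[B] T)
    (d' : P₁' →ₗ[A] P₀') (π' : P₀' →ₗ[A] X') (p' : (P₁' →ₗ[A] D) →ₗ[B] T')
    (f : X →ₗ[A] X') (t : T' →ₗ[B] T) : Prop :=
  ∃ (h₀ : P₀ →ₗ[A] P₀') (h₁ : P₁ →ₗ[A] P₁'),
    π' ∘ₗ h₀ = f ∘ₗ π ∧ d' ∘ₗ h₁ = h₀ ∘ₗ d ∧ t ∘ₗ p' = p ∘ₗ dualMap B D h₁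

/-- A presentation `P₁ → P₀ → X → 0` such that `Hom(P₀, D) → Hom(P₁, D) → T → 0` is exact. -/
structure TrPres {P₁ P₀ X T : Type u} [AddCommGroup P₁] [Module A P₁] [AddCommGroup P₀]
    [Module A P₀] [AddCommGroup X] [Module A X] [AddCommGroup T] [Module B T]
    (d : P₁ →ₗ[A] P₀) (π : P₀ →ₗ[A] X) (p : (P₁ →ₗ[A] D) →ₗ[B] T) : Prop where
  exact : Function.Exact d π
  surj : Function.Surjective π
  exact' : Function.Exact (dualMap B D d) p
  surj' : Function.Surjective p

variable {B D}
variable {P₁ P₀ X T P₁' P₀' X' T' P₁'' P₀'' X'' T'' : Type u}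
  [AddCommGroup P₁] [Module A P₁] [AddCommGroup P₀]
  [Module A P₀] [AddCommGroup X] [Module A X] [AddCommGroup T] [Module B T] [AddCommGroup P₁']
  [Module A P₁'] [AddCommGroup P₀'] [Module A P₀'] [AddCommGroup X'] [Module A X']
  [AddCommGroup T'] [Module B T'] [AddCommGroup P₁'']
  [Module A P₁''] [AddCommGroup P₀''] [Module A P₀''] [AddCommGroup X''] [Module A X'']
  [AddCommGroup T''] [Module B T'']
  {d : P₁ →ₗ[A] P₀} {π : P₀ →ₗ[A] X} {p : (P₁ →ₗ[A] D) →ₗ[B] T}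
  {d' : P₁' →ₗ[A] P₀'} {π' : P₀' →ₗ[A] X'} {p' : (P₁' →ₗ[A] D) →ₗ[B] T'}
  {d'' : P₁'' →ₗ[A] P₀''} {π'' : P₀'' →ₗ[A] X''} {p'' : (P₁'' →ₗ[A] D) →ₗ[B] T''}

lemma exists_lift_of_exact [Module.Projective A X] {d : P₁ →ₗ[A] P₀} {π : P₀ →ₗ[A] X'}
    (H : Function.Exact d π) (h : X →ₗ[A] P₀) (hh : π ∘ₗ h = 0) :
    ∃ k : X →ₗ[A] P₁, d ∘ₗ k = h := by
  obtain ⟨k, hk⟩ := Module.projective_lifting_property d.rangeRestrict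
    (LinearMap.codRestrict (LinearMap.range d) h
      fun x => (H _).1 (LinearMap.congr_fun hh x)) d.surjective_rangeRestrict
  refine ⟨k, LinearMap.ext fun x => ?_⟩
  exact congrArg Subtype.val (LinearMap.congr_fun hk x)

lemma exists_desc_of_exact {d : P₁ →ₗ[A] P₀} {π : P₀ →ₗ[A] X}
    (H : Function.Exact d π) (hπ : Function.Surjective π) (h : P₀ →ₗ[A] X') (hh : h ∘ₗ d = 0) :
    ∃ k : X →ₗ[A] X', k ∘ₗ π = h := by
  have hle : LinearMap.ker π ≤ LinearMap.ker h := by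
    intro x hx
    obtain ⟨y, rfl⟩ := (H x).1 hx
    exact LinearMap.congr_fun hh y
  refine ⟨Submodule.liftQ _ h hle ∘ₗ (π.quotKerEquivOfSurjective hπ).symm.toLinearMap, ?_⟩
  ext x
  have : (π.quotKerEquivOfSurjective hπ).symm (π x) = (LinearMap.ker π).mkQ x := by
    rw [LinearEquiv.symm_apply_eq]; rfl
  simp [this]

lemma TrRel.id : TrRel B D d π p d π p LinearMap.id LinearMap.id :=
  ⟨LinearMap.id, LinearMap.id, rfl, rfl, rfl⟩

lemma TrRel.comp {f' : X' →ₗ[A] X''} {t' : T'' →ₗ[B] T'} {f : X →ₗ[A] X'} {t : T' →ₗ[B] T}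
    (H' : TrRel B D d' π' p' d'' π'' p'' f' t') (H : TrRel B D d π p d' π' p' f t) :
    TrRel B D d π p d'' π'' p'' (f' ∘ₗ f) (t ∘ₗ t') := by
  obtain ⟨h₀, h₁, e0, e1, e2⟩ := H'
  obtain ⟨h₀', h₁', e0', e1', e2'⟩ := H
  refine ⟨h₀ ∘ₗ h₀', h₁ ∘ₗ h₁', ?_, ?_, ?_⟩
  · rw [← LinearMap.comp_assoc, e0, LinearMap.comp_assoc, e0', LinearMap.comp_assoc]
  · rw [← LinearMap.comp_assoc, e1, LinearMap.comp_assoc, e1', LinearMap.comp_assoc]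
  · rw [LinearMap.comp_assoc, e2, ← LinearMap.comp_assoc, e2', LinearMap.comp_assoc]
    rfl

lemma TrRel.sub {f f' : X →ₗ[A] X'} {t t' : T' →ₗ[B] T} (H : TrRel B D d π p d' π' p' f t)
    (H' : TrRel B D d π p d' π' p' f' t') : TrRel B D d π p d' π' p' (f - f') (t - t') := by
  obtain ⟨h₀, h₁, e0, e1, e2⟩ := H
  obtain ⟨h₀', h₁', e0', e1', e2'⟩ := H'
  refine ⟨h₀ - h₀', h₁ - h₁', by rw [LinearMap.comp_sub, LinearMap.sub_comp, e0, e0'],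
    by rw [LinearMap.comp_sub, LinearMap.sub_comp, e1, e1'], ?_⟩
  rw [LinearMap.sub_comp, e2, e2', ← LinearMap.comp_sub, dualMap_sub]

lemma TrPres.exists_rel [Module.Projective A P₀] [Module.Projective A P₁]
    (H : TrPres B D d π p) (H' : TrPres B D d' π' p') (f : X →ₗ[A] X') :
    ∃ t, TrRel B D d π p d' π' p' f t := by
  obtain ⟨h₀, e0⟩ := Module.projective_lifting_property π' (f ∘ₗ π) H'.surj
  obtain ⟨h₁, e1⟩ := exists_lift_of_exact H'.exact (h₀ ∘ₗ d) (by
    rw [← LinearMap.comp_assoc, e0, LinearMap.comp_assoc, H.exact.linearMap_comp_eq_zero,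
      LinearMap.comp_zero])
  obtain ⟨t, ht⟩ := exists_desc_of_exact H'.exact' H'.surj' (p ∘ₗ dualMap B D h₁) (by
    rw [LinearMap.comp_assoc, ← dualMap_comp, e1, dualMap_comp, ← LinearMap.comp_assoc,
      H.exact'.linearMap_comp_eq_zero, LinearMap.zero_comp])
  exact ⟨t, h₀, h₁, e0, e1, ht⟩

/-- A homomorphism of transposes induced by one which factors through a projective module
factors through the projection onto the transpose. -/
lemma TrRel.factors {Q : Type u} [AddCommGroup Q] [Module A Q] [Module.Projective A Q]
    [Module.Projective A P₀]
    (H : TrPres B D d π p) (H' : TrPres B D d' π' p') {f : X →ₗ[A] X'} {t : T' →ₗ[B] T}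
    (h : TrRel B D d π p d' π' p' f t) (a : X →ₗ[A] Q) (b : Q →ₗ[A] X') (hab : f = b ∘ₗ a) :
    ∃ c : T' →ₗ[B] (P₁ →ₗ[A] D), t = p ∘ₗ c := by
  obtain ⟨h₀, h₁, e0, e1, e2⟩ := h
  obtain ⟨c, hc⟩ := Module.projective_lifting_property π' b H'.surj
  obtain ⟨k, hk⟩ := exists_lift_of_exact H'.exact (h₀ - c ∘ₗ a ∘ₗ π) (by
    rw [LinearMap.comp_sub, e0, hab, ← LinearMap.comp_assoc, hc, LinearMap.comp_assoc, sub_self])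
  -- The homotopy k corrects h₁ to a map killed by d', whose dual descends to T'. The correction
  -- dualizes into the image of `dualMap B D d`, which p kills.
  have e3 : d' ∘ₗ (h₁ - k ∘ₗ d) = 0 := by
    rw [LinearMap.comp_sub, ← LinearMap.comp_assoc, hk, e1, LinearMap.sub_comp,
      LinearMap.comp_assoc, LinearMap.comp_assoc, H.exact.linearMap_comp_eq_zero,
      LinearMap.comp_zero, LinearMap.comp_zero, sub_zero, sub_self]
  obtain ⟨s, hs⟩ := exists_desc_of_exact H'.exact' H'.surj' (dualMap B D (h₁ - k ∘ₗ d)) (by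
    rw [← dualMap_comp, e3, dualMap_zero])
  refine ⟨s, (LinearMap.cancel_right H'.surj').1 ?_⟩
  rw [e2, LinearMap.comp_assoc, hs, dualMap_sub, LinearMap.comp_sub, dualMap_comp,
    ← LinearMap.comp_assoc, H.exact'.linearMap_comp_eq_zero,
    LinearMap.zero_comp, sub_zero]

section Symm

variable [SMulCommClass B A D] [IsEndRing A B D] [Module.Finite A P₀] [Module.Projective A P₀]

/-- The second dual of the projection `π : P₀ → X`. -/
abbrev biProj (π : P₀ →ₗ[A] X) : ((P₀ →ₗ[A] D) →ₗ[B] D) →ₗ[A] X :=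
  π ∘ₗ (evEquiv A B D P₀).symm.toLinearMap

section

variable [Module.Finite A P₁] [Module.Projective A P₁]

lemma evEquiv_symm_dualMap (d : P₁ →ₗ[A] P₀) :
    (evEquiv A B D P₀).symm.toLinearMap ∘ₗ dualMap A D (dualMap B D d) =
      d ∘ₗ (evEquiv A B D P₁).symm.toLinearMap := by
  apply LinearMap.ext
  intro ψ
  obtain ⟨x, rfl⟩ := (evEquiv A B D P₁).surjective ψ
  simp only [LinearMap.comp_apply, LinearEquiv.coe_coe, LinearEquiv.symm_apply_apply]
  rw [LinearEquiv.symm_apply_eq]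
  rfl

/-- The module `X` is a transpose of each of its transposes. -/
lemma TrPres.symm (H : TrPres B D d π p) : TrPres A D (dualMap B D d) p (biProj π) where
  exact := H.exact'
  surj := H.surj'
  -- Under the evaluation isomorphisms the second dual of d is d itself.
  exact' := by
    intro ψ
    obtain ⟨x, rfl⟩ := (evEquiv A B D P₀).surjective ψ
    have : biProj (B := B) (D := D) π (evEquiv A B D P₀ x) = π x := by simp
    rw [this, H.exact x]
    constructor
    · rintro ⟨y, rfl⟩
      exact ⟨evEquiv A B D P₁ y, rfl⟩
    · rintro ⟨ψ, h⟩
      obtain ⟨y, rfl⟩ := (evEquiv A B D P₁).surjective ψ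
      exact ⟨y, (evEquiv A B D P₀).injective h⟩
  surj' := H.surj.comp (evEquiv A B D P₀).symm.surjective

end

variable [Module.Finite A P₀'] [Module.Projective A P₀']

/-- The duals of (h₁, h₀) lift t, and dualizing once more returns (h₀, h₁) by biduality: f is a
transpose of t. -/
lemma TrRel.symm {f : X →ₗ[A] X'} {t : T' →ₗ[B] T} (H : TrRel B D d π p d' π' p' f t) :
    TrRel A D (dualMap B D d') p' (biProj π') (dualMap B D d) p (biProj π) t f := by
  obtain ⟨h₀, h₁, e0, e1, e2⟩ := H
  refine ⟨dualMap B D h₁, dualMap B D h₀, e2.symm, ?_, ?_⟩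
  · rw [← dualMap_comp, ← dualMap_comp, e1]
  · rw [biProj, biProj, LinearMap.comp_assoc, evEquiv_symm_dualMap, ← LinearMap.comp_assoc,
      ← LinearMap.comp_assoc, e0]

end Symm

end TrPres

/-! ### Stable homomorphisms induced by homomorphisms of presentations -/

section StableRel

variable {A : Type u} [Ring A]

/-- A linear map as a morphism of finitely generated modules. -/
def fgHom {X Y : FGModuleCat.{u} A} (f : X →ₗ[A] Y) : X ⟶ Y :=
  ObjectProperty.homMk (ModuleCat.ofHom f)

lemma projRel_of_factors {X Y : FGModuleCat.{u} A} {f g : X ⟶ Y} (Q : Type u) [AddCommGroup Q]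
    [Module A Q] [Module.Finite A Q] [Module.Projective A Q] (a : X →ₗ[A] Q) (b : Q →ₗ[A] Y)
    (h : f.hom.hom - g.hom.hom = b ∘ₗ a) : (toStable A).map f = (toStable A).map g :=
  CategoryTheory.Quotient.sound _ ⟨FGModuleCat.of A Q, inferInstanceAs (Module.Projective A Q),
    a, b, h⟩

section

variable {P N P' N' : Type u} {K K' : FGModuleCat.{u} A} [AddCommGroup P]
  [Module A P] [AddCommGroup N] [Module A N] [AddCommGroup P']
  [Module A P'] [AddCommGroup N'] [Module A N']
  {i : K →ₗ[A] P} {π : P →ₗ[A] N} {i' : K' →ₗ[A] P'} {π' : P' →ₗ[A] N'}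

/-- The difference of the two maps is induced by 0, which factors through the zero module; hence it
factors through i and the projective P. -/
lemma SyzRel.stable_eq [Module.Finite A P] [Module.Projective A P] (hi : π ∘ₗ i = 0)
    (H' : SyzPres i' π') {f : N →ₗ[A] N'} {g g' : K ⟶ K'}
    (h : SyzRel i π i' π' f g.hom.hom) (h' : SyzRel i π i' π' f g'.hom.hom) :
    (toStable A).map g = (toStable A).map g' := by
  obtain ⟨k, hk⟩ := (h.sub h').factors (Q := PUnit) hi H' 0 0 (by simp)
  exact projRel_of_factors P i k hk

/-- A homomorphism between syzygies of the same module induced by the identity is a stable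
isomorphism. -/
lemma SyzRel.isIso [Module.Finite A P] [Module.Projective A P] [Module.Finite A P']
    [Module.Projective A P'] {π' : P' →ₗ[A] N} (H : SyzPres i π)
    (H' : SyzPres i' π') {g : K ⟶ K'} (h : SyzRel i π i' π' LinearMap.id g.hom.hom) :
    IsIso ((toStable A).map g) := by
  obtain ⟨s, hs⟩ := SyzPres.exists_rel H'.exact.linearMap_comp_eq_zero H LinearMap.id
  refine ⟨(toStable A).map (fgHom s), ?_, ?_⟩
  · rw [← (toStable A).map_comp, ← (toStable A).map_id]
    exact SyzRel.stable_eq H.exact.linearMap_comp_eq_zero H (hs.comp h) SyzRel.id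
  · rw [← (toStable A).map_comp, ← (toStable A).map_id]
    exact SyzRel.stable_eq H'.exact.linearMap_comp_eq_zero H' (h.comp hs) SyzRel.id

end

section

variable {B : Type u} [Ring B] {D : Type u} [AddCommGroup D] [Module A D]
  [Module B D] [SMulCommClass A B D] [Module.Finite B D] [Module.Projective B D]
  {P₁ P₀ X P₁' P₀' X' : Type u} {T T' : FGModuleCat.{u} B}
  [AddCommGroup P₁] [Module A P₁] [AddCommGroup P₀]
  [Module A P₀] [AddCommGroup X] [Module A X] [AddCommGroup P₁']
  [Module A P₁'] [AddCommGroup P₀'] [Module A P₀'] [AddCommGroup X'] [Module A X']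
  {d : P₁ →ₗ[A] P₀} {π : P₀ →ₗ[A] X} {p : (P₁ →ₗ[A] D) →ₗ[B] T}
  {d' : P₁' →ₗ[A] P₀'} {π' : P₀' →ₗ[A] X'} {p' : (P₁' →ₗ[A] D) →ₗ[B] T'}
  [Module.Finite A P₁] [Module.Projective A P₁] [Module.Projective A P₀]

lemma TrRel.stable_eq (H : TrPres B D d π p) (H' : TrPres B D d' π' p') {f : X →ₗ[A] X'}
    {t t' : T' ⟶ T} (h : TrRel B D d π p d' π' p' f t.hom.hom)
    (h' : TrRel B D d π p d' π' p' f t'.hom.hom) :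
    (toStable B).map t = (toStable B).map t' := by
  obtain ⟨k, hk⟩ := (h.sub h').factors (Q := PUnit) H H' 0 0 (by simp)
  exact projRel_of_factors _ k p hk

variable [Module.Finite A P₁'] [Module.Projective A P₁'] [Module.Projective A P₀']

/-- A homomorphism between transposes of the same module induced by the identity is a stable
isomorphism. -/
lemma TrRel.isIso {π' : P₀' →ₗ[A] X} (H : TrPres B D d π p) (H' : TrPres B D d' π' p')
    {t : T' ⟶ T} (h : TrRel B D d π p d' π' p' LinearMap.id t.hom.hom) :
    IsIso ((toStable B).map t) := by
  obtain ⟨s, hs⟩ := TrPres.exists_rel H' H LinearMap.id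
  refine ⟨(toStable B).map (fgHom s), ?_, ?_⟩
  · rw [← (toStable B).map_comp, ← (toStable B).map_id]
    exact TrRel.stable_eq H' H' (h.comp hs) TrRel.id
  · rw [← (toStable B).map_comp, ← (toStable B).map_id]
    exact TrRel.stable_eq H H (hs.comp h) TrRel.id

end

/-- Two finitely generated modules are isomorphic in the stable category. -/
def StIso (X Y : FGModuleCat.{u} A) : Prop :=
  Nonempty ((toStable A).obj X ≅ (toStable A).obj Y)

lemma StIso.symm {X Y : FGModuleCat.{u} A} (h : StIso X Y) : StIso Y X := ⟨h.some.symm⟩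

lemma StIso.trans {X Y Z : FGModuleCat.{u} A} (h : StIso X Y) (h' : StIso Y Z) : StIso X Z :=
  ⟨h.some ≪≫ h'.some⟩

lemma StIso.of_linearEquiv {X Y : FGModuleCat.{u} A} (e : X ≃ₗ[A] Y) : StIso X Y :=
  ⟨(toStable A).mapIso
    { hom := fgHom e.toLinearMap
      inv := fgHom e.symm.toLinearMap
      hom_inv_id := by ext x; exact e.symm_apply_apply x
      inv_hom_id := by ext x; exact e.apply_symm_apply x }⟩

end StableRel

section Syzygy

variable {A : Type u} [Ring A] [IsNoetherianRing A]

lemma syzPres_syz (M : FGModuleCat.{u} A) : SyzPres (syzIncl M) (cover M) where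
  inj := syzIncl_injective M
  exact := by
    intro x
    exact ⟨fun h => ⟨⟨x, h⟩, rfl⟩, by rintro ⟨y, rfl⟩; exact y.2⟩
  surj := cover_surjective M

/-- Schanuel's lemma in stable form: any finitely generated projective cover computes Ω. -/
lemma StIso.of_syzPres {P : Type u} {K N : FGModuleCat.{u} A} [AddCommGroup P] [Module A P]
    [Module.Finite A P] [Module.Projective A P] {i : K →ₗ[A] P} {π : P →ₗ[A] N}
    (H : SyzPres i π) : StIso K (syz N) := by
  obtain ⟨g, hg⟩ := SyzPres.exists_rel H.exact.linearMap_comp_eq_zero (syzPres_syz N)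
    LinearMap.id
  have := SyzRel.isIso (g := fgHom g) H (syzPres_syz N) hg
  exact ⟨asIso ((toStable A).map (fgHom g))⟩

lemma StIso.map_syz {X Y : FGModuleCat.{u} A} (h : StIso X Y) : StIso (syz X) (syz Y) :=
  ⟨(syzFunctor A).mapIso h.some⟩

end Syzygy

section Transpose

variable {A : Type u} [Ring A] [IsNoetherianRing A] {B : Type u} [Ring B]
  {D : Type u} [AddCommGroup D] [Module A D] [Module B D]
  [SMulCommClass A B D] [Module.Finite B D]

lemma exact_presMap (M : FGModuleCat.{u} A) : Function.Exact (presMap M) (cover M) := by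
  intro x
  rw [(syzPres_syz M).exact x]
  constructor
  · rintro ⟨y, rfl⟩
    obtain ⟨z, rfl⟩ := cover_surjective _ y
    exact ⟨z, rfl⟩
  · rintro ⟨y, rfl⟩
    exact ⟨_, rfl⟩

variable (B D) in
/-- The projection `trProj`, with the transpose as a finitely generated module. -/
def trPr (M : FGModuleCat.{u} A) : (Cover (syz M) →ₗ[A] D) →ₗ[B] tr B D M := trProj B D M

variable (B D) in
lemma trPres_tr (M : FGModuleCat.{u} A) :
    TrPres B D (presMap M) (cover M) (trPr B D M) where
  exact := exact_presMap M
  surj := cover_surjective M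
  exact' _ := Submodule.Quotient.mk_eq_zero _
  surj' := Submodule.mkQ_surjective _

variable [Module.Projective B D]

/-- Up to stable isomorphism, Tr does not depend on the projective presentation. -/
lemma StIso.of_trPres {P₁ P₀ : Type u} {X : FGModuleCat.{u} A} {T : FGModuleCat.{u} B}
    [AddCommGroup P₁] [Module A P₁] [AddCommGroup P₀] [Module A P₀]
    {d : P₁ →ₗ[A] P₀} {π : P₀ →ₗ[A] X} {p : (P₁ →ₗ[A] D) →ₗ[B] T}
    [Module.Finite A P₁] [Module.Projective A P₁] [Module.Projective A P₀]
    (H : TrPres B D d π p) : StIso T (tr B D X) := by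
  obtain ⟨t, ht⟩ := TrPres.exists_rel (trPres_tr B D X) H LinearMap.id
  have := TrRel.isIso (t := (fgHom t : T ⟶ tr B D X)) (trPres_tr B D X) H ht
  exact ⟨asIso ((toStable B).map (fgHom t : T ⟶ tr B D X))⟩

lemma StIso.map_tr {X Y : FGModuleCat.{u} A} (h : StIso X Y) : StIso (tr B D X) (tr B D Y) :=
  have e := (trFunctor A B D).mapIso h.some.symm.op
  ⟨e⟩

end Transpose

/-! ### The transpose is a duality -/

section Duality

variable (A : Type u) [Ring A] [IsNoetherianRing A] (B : Type u) [Ring B] [IsNoetherianRing B]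
  (D : Type u) [AddCommGroup D] [Module A D] [Module B D] [SMulCommClass A B D]
  [SMulCommClass B A D] [IsEndRing A B D] [Module.Finite A D] [Module.Finite B D]
  [Module.Projective A D] [Module.Projective B D]

variable {A} in
lemma trPres_symm (X : FGModuleCat.{u} A) : TrPres (T := X) A D
    (dualMap B D (presMap X)) (trPr B D X) (biProj (cover X)) :=
  (trPres_tr B D X).symm

variable {A} in
lemma exists_trTr (X : FGModuleCat.{u} A) : ∃ t : tr A D (tr B D X) →ₗ[A] X,
    TrRel A D (dualMap B D (presMap X)) (trPr B D X) (biProj (cover X))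
      (presMap (tr B D X)) (cover (tr B D X)) (trPr A D (tr B D X)) LinearMap.id t :=
  TrPres.exists_rel (trPres_symm B D X) (trPres_tr A D (tr B D X)) LinearMap.id

variable {A} in
/-- The comparison of the double transpose of `X` with `X`. -/
def trTrHom (X : FGModuleCat.{u} A) : tr A D (tr B D X) ⟶ X :=
  fgHom (exists_trTr B D X).choose

variable {A} in
lemma trRel_trTrHom (X : FGModuleCat.{u} A) :
    TrRel A D (dualMap B D (presMap X)) (trPr B D X) (biProj (cover X))
      (presMap (tr B D X)) (cover (tr B D X)) (trPr A D (tr B D X)) LinearMap.id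
      (trTrHom B D X).hom.hom :=
  (exists_trTr B D X).choose_spec

lemma isIso_trTrHom (X : FGModuleCat.{u} A) : IsIso ((toStable A).map (trTrHom B D X)) :=
  TrRel.isIso (trPres_symm B D X) (trPres_tr A D (tr B D X)) (trRel_trTrHom B D X)

/-- Both composites are induced by the same map Tr f between the same presentations: one through Tr
Tr f, the other through `TrRel.symm`, which exhibits f as a transpose of Tr f. -/
lemma trTrHom_natural {X Y : FGModuleCat.{u} A} (f : X ⟶ Y) :
    (toStable A).map (trHom (D := D) (trHom (B := B) (D := D) f)) ≫
      (toStable A).map (trTrHom B D Y) =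
    (toStable A).map (trTrHom B D X) ≫ (toStable A).map f := by
  rw [← (toStable A).map_comp, ← (toStable A).map_comp]
  have h1 := isTrMap_trMap B D f
  have h2 := isTrMap_trMap A D (trHom (B := B) (D := D) f)
  have e1 := TrRel.comp h2 (trRel_trTrHom B D Y)
  have e2 := TrRel.comp (trRel_trTrHom B D X) (TrRel.symm h1)
  exact TrRel.stable_eq (trPres_symm B D Y) (trPres_tr A D (tr B D X)) e1 e2

/-- The transpose is a duality of stable categories. -/
def trTrIso : (trFunctor A B D).rightOp ⋙ trFunctor B A D ≅ 𝟭 (StableCat A) :=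
  CategoryTheory.Quotient.natIsoLift _ (NatIso.ofComponents
    (fun X => @asIso _ _ _ _ ((toStable A).map (trTrHom B D X)) (isIso_trTrHom A B D X))
    fun f => trTrHom_natural A B D f)

end Duality

/-! ### The comparison of `Tr` with `Ω Tr Ω` -/

section Theta

variable {A : Type u} [Ring A] [IsNoetherianRing A] (B : Type u) [Ring B] [IsNoetherianRing B]
  (D : Type u) [AddCommGroup D] [Module A D] [Module B D] [SMulCommClass A B D]
  [Module.Finite B D] [Module.Projective B D]

lemma exists_trDelta (X : FGModuleCat.{u} A) :
    ∃ δ : tr B D X →ₗ[B] (Cover (syz (syz X)) →ₗ[A] D),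
      δ ∘ₗ (trPr B D X) = dualMap B D (presMap (syz X)) :=
  exists_desc_of_exact (trPres_tr B D X).exact' (trPres_tr B D X).surj' _ (by
    rw [← dualMap_comp, presMap, LinearMap.comp_assoc, cover_comp_presMap, LinearMap.comp_zero,
      dualMap_zero])

/-- The map from `Tr X` to the dual of the next term of the free resolution of `X`. -/
def trDelta (X : FGModuleCat.{u} A) : tr B D X →ₗ[B] (Cover (syz (syz X)) →ₗ[A] D) :=
  (exists_trDelta B D X).choose

lemma trDelta_comp (X : FGModuleCat.{u} A) :
    trDelta B D X ∘ₗ (trPr B D X) = dualMap B D (presMap (syz X)) :=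
  (exists_trDelta B D X).choose_spec

lemma trDelta_trPr (X : FGModuleCat.{u} A) (φ : Cover (syz X) →ₗ[A] D) :
    trDelta B D X ((trPr B D X) φ) = φ ∘ₗ presMap (syz X) :=
  LinearMap.congr_fun (trDelta_comp B D X) φ

lemma exact_trDelta (X : FGModuleCat.{u} A) :
    Function.Exact (trDelta B D X) (trPr B D (syz X)) := by
  intro φ
  rw [(trPres_tr B D (syz X)).exact' φ]
  constructor
  · rintro ⟨ψ, rfl⟩
    exact ⟨_, trDelta_trPr B D X ψ⟩
  · rintro ⟨x, rfl⟩
    obtain ⟨ψ, rfl⟩ := (trPres_tr B D X).surj' x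
    exact ⟨ψ, (trDelta_trPr B D X ψ).symm⟩

lemma exists_theta (X : FGModuleCat.{u} A) : ∃ g : tr B D X →ₗ[B] syz (tr B D (syz X)),
    SyzRel (trDelta B D X) (trPr B D (syz X))
      (syzIncl (tr B D (syz X))) (cover (tr B D (syz X))) LinearMap.id g :=
  SyzPres.exists_rel (exact_trDelta B D X).linearMap_comp_eq_zero (syzPres_syz _) _

/-- The comparison of `Tr X` with `Ω Tr Ω X`. -/
def thetaHom (X : FGModuleCat.{u} A) : tr B D X ⟶ syz (tr B D (syz X)) :=
  fgHom (exists_theta B D X).choose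

lemma syzRel_thetaHom (X : FGModuleCat.{u} A) :
    SyzRel (trDelta B D X) (trPr B D (syz X))
      (syzIncl (tr B D (syz X))) (cover (tr B D (syz X))) LinearMap.id
      (thetaHom B D X).hom.hom :=
  (exists_theta B D X).choose_spec

lemma trHom_trPr {X Y : FGModuleCat.{u} A} (f : X ⟶ Y) (φ : Cover (syz Y) →ₗ[A] D) :
    (trHom (B := B) (D := D) f).hom.hom ((trPr B D Y) φ) =
      (trPr B D X) (φ ∘ₗ coverMap (syzMap f)) :=
  LinearMap.congr_fun (exists_trMap B D f).choose_spec φ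

lemma presMap_comp_coverMap {X Y : FGModuleCat.{u} A} (f : X ⟶ Y) :
    presMap Y ∘ₗ coverMap (syzMap f) = coverMap f ∘ₗ presMap X := by
  rw [presMap, LinearMap.comp_assoc, coverMap_spec, ← LinearMap.comp_assoc, syzMap_spec,
    LinearMap.comp_assoc, presMap]

/-- The dual of the lift P₂ → P₂' of f covers Tr Ωf and restricts to Tr f along `trDelta`; this
yields the naturality of the comparison. -/
lemma syzRel_trHom {X Y : FGModuleCat.{u} A} (f : X ⟶ Y) :
    SyzRel (trDelta B D Y) (trPr B D (syz Y))
      (trDelta B D X) (trPr B D (syz X))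
      (trHom (B := B) (D := D) (syzMap f)).hom.hom (trHom (B := B) (D := D) f).hom.hom := by
  refine ⟨dualMap B D (coverMap (syzMap (syzMap f))), ?_, ?_⟩
  · exact LinearMap.ext fun φ => (trHom_trPr B D (syzMap f) φ).symm
  · refine LinearMap.ext fun x => ?_
    obtain ⟨φ, rfl⟩ := (trPres_tr B D Y).surj' x
    simp only [LinearMap.comp_apply]
    rw [trHom_trPr, trDelta_trPr, trDelta_trPr, LinearMap.comp_assoc,
      ← presMap_comp_coverMap]
    rfl

lemma thetaHom_natural {X Y : FGModuleCat.{u} A} (f : X ⟶ Y) :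
    (toStable B).map (trHom (B := B) (D := D) f) ≫ (toStable B).map (thetaHom B D X) =
    (toStable B).map (thetaHom B D Y) ≫
      (toStable B).map (syzMap (trHom (B := B) (D := D) (syzMap f))) := by
  rw [← (toStable B).map_comp, ← (toStable B).map_comp]
  have e1 := (syzRel_thetaHom B D X).comp (syzRel_trHom B D f)
  have e2 := SyzRel.comp (isSyzMap_syzMap (trHom (B := B) (D := D) (syzMap f)))
    (syzRel_thetaHom B D Y)
  exact SyzRel.stable_eq (exact_trDelta B D Y).linearMap_comp_eq_zero (syzPres_syz _) e1 e2

variable (A) in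
/-- The natural transformation `Tr ⟶ Ω Tr Ω`. -/
def theta : trFunctor A B D ⟶ (syzFunctor A).op ⋙ trFunctor A B D ⋙ syzFunctor B where
  app X := (toStable B).map (thetaHom B D X.unop.as)
  naturality := by
    rintro ⟨Y⟩ ⟨X⟩ f
    obtain ⟨f, rfl⟩ : ∃ g : X ⟶ Y, g.op = f := ⟨f.unop, rfl⟩
    obtain ⟨f, rfl⟩ := (toStable A).map_surjective f
    exact thetaHom_natural B D f

/-- The hypothesis is Ext¹(X, D) = 0 in concrete form. It makes `trDelta` injective: a functional on
P₁ vanishing on the image of P₂ descends to ΩX, extends to P₀, and so is zero in Tr X. Then Tr X is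
itself a syzygy of Tr ΩX. -/
lemma isIso_thetaHom (X : FGModuleCat.{u} A)
    (h : ∀ φ : syz X →ₗ[A] D, ∃ ψ : Cover X →ₗ[A] D, ψ ∘ₗ syzIncl X = φ) :
    IsIso ((toStable B).map (thetaHom B D X)) := by
  refine SyzRel.isIso ⟨?_, exact_trDelta B D X, (trPres_tr B D (syz X)).surj'⟩
    (syzPres_syz _) (syzRel_thetaHom B D X)
  rw [injective_iff_map_eq_zero]
  intro x hx
  obtain ⟨φ, rfl⟩ := (trPres_tr B D X).surj' x
  rw [trDelta_trPr] at hx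
  obtain ⟨ψ, rfl⟩ := exists_desc_of_exact (exact_presMap (syz X)) (cover_surjective (syz X)) φ hx
  obtain ⟨χ, rfl⟩ := h ψ
  exact trProj_eq_zero B D X χ

end Theta

/-! ### Long exact sequences -/

section Ext

open CategoryTheory.Abelian

variable {A : Type u} [Ring A] {K P N : Type u} [AddCommGroup K] [Module A K] [AddCommGroup P]
  [Module A P] [AddCommGroup N] [Module A N] {i : K →ₗ[A] P} {π : P →ₗ[A] N}

/-- The short complex of a short exact sequence of modules. -/
abbrev SyzPres.shortComplex (H : SyzPres i π) : ShortComplex (ModuleCat.{u} A) :=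
  ShortComplex.mk (ModuleCat.ofHom i) (ModuleCat.ofHom π)
    (ModuleCat.hom_ext H.exact.linearMap_comp_eq_zero)

lemma SyzPres.shortExact (H : SyzPres i π) : H.shortComplex.ShortExact where
  exact := (ShortComplex.ShortExact.moduleCat_exact_iff_function_exact _).2 H.exact
  mono_f := (ModuleCat.mono_iff_injective _).2 H.inj
  epi_g := (ModuleCat.epi_iff_surjective _).2 H.surj

variable (D : Type u) [AddCommGroup D] [Module A D]

variable (A) in
/-- The vanishing of `Extⁱ_A(M, D)`, for modules as types. -/
abbrev EV (M : Type u) [AddCommGroup M] [Module A M] (i : ℕ) : Prop :=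
  ExtVanishes A D (ModuleCat.of A M) i

variable {D}

lemma ev_iff {M : Type u} [AddCommGroup M] [Module A M] {i : ℕ} :
    EV A D M i ↔ ∀ x : Ext.{u} (ModuleCat.of A M) (ModuleCat.of A D) i, x = 0 :=
  ⟨fun h x => @Subsingleton.elim _ h x 0, fun h => ⟨fun x y => (h x).trans (h y).symm⟩⟩

lemma SyzPres.ev_mid (H : SyzPres i π) {n : ℕ} (h : EV A D K n) (h' : EV A D N n) : EV A D P n := by
  rw [ev_iff] at h h' ⊢
  intro x
  obtain ⟨y, rfl⟩ := Ext.contravariant_sequence_exact₂ H.shortExact _ x (h _)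
  rw [h' y, Ext.comp_zero]

lemma SyzPres.ev_left (H : SyzPres i π) {n : ℕ} (h : EV A D P n) (h' : EV A D N (n + 1)) :
    EV A D K n := by
  rw [ev_iff] at h h' ⊢
  intro x
  obtain ⟨y, rfl⟩ := Ext.contravariant_sequence_exact₁ H.shortExact _ x (add_comm 1 n) (h' _)
  rw [h y, Ext.comp_zero]

lemma SyzPres.ev_right (H : SyzPres i π) {n : ℕ} (h : EV A D K n) (h' : EV A D P (n + 1)) :
    EV A D N (n + 1) := by
  rw [ev_iff] at h h' ⊢
  intro x
  obtain ⟨y, rfl⟩ := Ext.contravariant_sequence_exact₃ H.shortExact _ x (h' _) (add_comm 1 n)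
  rw [h y, Ext.comp_zero]

lemma ev_of_projective [Module.Projective A P] (n : ℕ) : EV A D P (n + 1) := by
  have : Projective (ModuleCat.of A P) := (IsProjective.iff_projective P).1 inferInstance
  exact Ext.subsingleton_of_projective _ _ _

lemma SyzPres.ev_succ_iff [Module.Projective A P] (H : SyzPres i π) (n : ℕ) :
    EV A D N (n + 2) ↔ EV A D K (n + 1) :=
  ⟨fun h => H.ev_left (ev_of_projective n) h, fun h => H.ev_right h (ev_of_projective (n + 1))⟩

lemma ev_zero_iff : EV A D N 0 ↔ ∀ φ : N →ₗ[A] D, φ = 0 := by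
  rw [ev_iff]
  constructor
  · intro h φ
    have := h (Ext.mk₀ (ModuleCat.ofHom φ))
    rw [Ext.mk₀_eq_zero_iff] at this
    exact congrArg ModuleCat.Hom.hom this
  · intro h x
    obtain ⟨f, rfl⟩ := Ext.addEquiv₀.symm.surjective x
    have : f = 0 := ModuleCat.hom_ext (h f.hom)
    rw [this, map_zero]

/-- The connecting homomorphism `Hom(K, D) → Ext¹(N, D)`. -/
def SyzPres.delta (H : SyzPres i π) (φ : K →ₗ[A] D) :
    Ext.{u} (ModuleCat.of A N) (ModuleCat.of A D) 1 :=
  H.shortExact.extClass.comp (Ext.mk₀ (ModuleCat.ofHom φ)) (add_zero 1)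

lemma SyzPres.delta_eq_zero_iff (H : SyzPres i π) (φ : K →ₗ[A] D) :
    H.delta φ = 0 ↔ ∃ ψ : P →ₗ[A] D, ψ ∘ₗ i = φ := by
  constructor
  · intro h
    obtain ⟨x, hx⟩ := Ext.contravariant_sequence_exact₁ H.shortExact _ _ (add_zero 1) h
    obtain ⟨ψ, rfl⟩ := Ext.addEquiv₀.symm.surjective x
    refine ⟨ψ.hom, ?_⟩
    change (Ext.mk₀ _).comp (Ext.mk₀ ψ) _ = _ at hx
    rw [Ext.mk₀_comp_mk₀] at hx
    exact congrArg ModuleCat.Hom.hom ((Ext.mk₀_bijective _ _).1 hx)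
  · rintro ⟨ψ, rfl⟩
    rw [delta, ModuleCat.ofHom_comp, ← Ext.mk₀_comp_mk₀]
    exact H.shortExact.extClass_comp_assoc _

lemma SyzPres.delta_surjective [Module.Projective A P] (H : SyzPres i π) :
    Function.Surjective (H.delta (D := D)) := by
  intro x
  obtain ⟨y, hy⟩ := Ext.contravariant_sequence_exact₃ H.shortExact _ x
    (ev_iff.1 (ev_of_projective 0) _) (add_zero 1)
  obtain ⟨φ, rfl⟩ := Ext.addEquiv₀.symm.surjective y
  exact ⟨φ.hom, hy⟩

lemma SyzPres.ev_one_iff [Module.Projective A P] (H : SyzPres i π) :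
    EV A D N 1 ↔ ∀ φ : K →ₗ[A] D, ∃ ψ : P →ₗ[A] D, ψ ∘ₗ i = φ := by
  rw [ev_iff]
  constructor
  · intro h φ
    exact (H.delta_eq_zero_iff φ).1 (h _)
  · intro h x
    obtain ⟨φ, rfl⟩ := H.delta_surjective x
    exact (H.delta_eq_zero_iff φ).2 (h φ)

lemma grdProp_iff {n : ℕ} {M : FGModuleCat.{u} A} :
    grdProp A D n M ↔ ∀ i < n, EV A D M i := by
  simp only [grdProp, modGrade, le_iInf_iff, Nat.cast_le]
  exact forall_congr' fun i => ⟨fun h hi => by_contra fun h' => absurd (h h') (by omega),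
    fun h h' => le_of_not_gt fun hi => h' (h hi)⟩

/-- The vanishing of `Ext` in positive degrees is invariant under stable isomorphism. -/
lemma StIso.ev (B : Type u) [Ring B] [Module B D] [SMulCommClass A B D] {M N : FGModuleCat.{u} A}
    (h : StIso M N) {n : ℕ} (hM : EV A D M (n + 1)) : EV A D N (n + 1) := by
  have e := (stableExt A B D (n + 1) (by omega)).mapIso h.some.op
  have : Subsingleton (extObj A B D (n + 1) M.obj) := hM
  exact @Equiv.subsingleton _ _
    (e.toLinearEquiv.toEquiv : extObj A B D (n + 1) N.obj ≃ extObj A B D (n + 1) M.obj) this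

end Ext

/-! ### Iterated syzygies and shifts of `Ext` -/

section Iterate

variable {A : Type u} [Ring A] [IsNoetherianRing A]

lemma syzPow_obj (k : ℕ) (M : FGModuleCat.{u} A) :
    (syzPow A k).obj ((toStable A).obj M) = (toStable A).obj (nsyz k M) := by
  induction k with
  | zero => rfl
  | succ k ih =>
    change (syzFunctor A).obj ((syzPow A k).obj _) = _
    rw [ih]
    rfl

variable (A) in
/-- The functor `Ωᵏ` commutes with `Ω`. -/
def syzPowComm : ∀ k : ℕ, syzFunctor A ⋙ syzPow A k ≅ syzPow A (k + 1)
  | 0 => Iso.refl _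
  | k + 1 => Functor.isoWhiskerRight (syzPowComm k) (syzFunctor A)

variable {D : Type u} [AddCommGroup D] [Module A D]

lemma ev_syz_iff (M : FGModuleCat.{u} A) (n : ℕ) :
    EV A D (syz M) (n + 1) ↔ EV A D M (n + 2) :=
  ((syzPres_syz M).ev_succ_iff n).symm

lemma ev_nsyz_iff (k : ℕ) (M : FGModuleCat.{u} A) (n : ℕ) :
    EV A D (nsyz k M) (n + 1) ↔ EV A D M (n + k + 1) := by
  induction k generalizing n with
  | zero => exact Iff.rfl
  | succ k ih =>
    rw [show n + (k + 1) + 1 = (n + 1) + k + 1 by omega, ← ih (n + 1)]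
    exact ev_syz_iff (nsyz k M) n

end Iterate

/-! ### Formal composition of the comparison maps -/

/-- The composite `T ⟶ U.op ⋙ T ⋙ U' ⟶ U.op ⋙ S.op ⋙ T ⋙ S' ⋙ U'`, up to an isomorphism
`S' ⋙ U' ≅ U''`. -/
def transStep {C E : Type*} [Category* C] [Category* E] {S U : C ⥤ C} {S' U' U'' : E ⥤ E}
    {T : Cᵒᵖ ⥤ E} (τ : T ⟶ S.op ⋙ T ⋙ S') (α : T ⟶ U.op ⋙ T ⋙ U') (c : S' ⋙ U' ≅ U'') :
    T ⟶ (U ⋙ S).op ⋙ T ⋙ U'' where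
  app X := α.app X ≫ U'.map (τ.app (Opposite.op (U.obj X.unop))) ≫
    c.hom.app (T.obj (Opposite.op (S.obj (U.obj X.unop))))
  naturality X Y f := by
    have h1 := α.naturality f
    have h2 := congrArg U'.map (τ.naturality (U.map f.unop).op)
    have h3 := c.hom.naturality (T.map (S.map (U.map f.unop)).op)
    simp only [Functor.comp_map, Functor.op_map, Functor.map_comp, Quiver.Hom.unop_op]
      at h1 h2 h3 ⊢
    rw [reassoc_of% h1, reassoc_of% h2, h3]
    simp only [Category.assoc]

lemma isIso_transStep {C E : Type*} [Category* C] [Category* E] {S U : C ⥤ C} {S' U' U'' : E ⥤ E}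
    {T : Cᵒᵖ ⥤ E} (τ : T ⟶ S.op ⋙ T ⋙ S') (α : T ⟶ U.op ⋙ T ⋙ U') (c : S' ⋙ U' ≅ U'') (X : Cᵒᵖ)
    (h : IsIso (α.app X)) (h' : IsIso (τ.app (Opposite.op (U.obj X.unop)))) :
    IsIso ((transStep τ α c).app X) := by
  rw [transStep]
  infer_instance

/-- The composite `T' U' T U ⟶ T' T ⟶ 𝟭` obtained from `T ⟶ U.op ⋙ T ⋙ U'`. -/
def transCounit {C E : Type*} [Category* C] [Category* E] {U : C ⥤ C} {U' : E ⥤ E}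
    {T : Cᵒᵖ ⥤ E} {T' : Eᵒᵖ ⥤ C} (α : T ⟶ U.op ⋙ T ⋙ U') (β : T.rightOp ⋙ T' ≅ 𝟭 C) :
    (U.op ⋙ T).rightOp ⋙ U'.op ⋙ T' ⟶ 𝟭 C where
  app X := T'.map (α.app (Opposite.op X)).op ≫ β.hom.app X
  naturality X Y f := by
    have h1 := congrArg (fun g => T'.map (Quiver.Hom.op g)) (α.naturality f.op)
    have h2 := β.hom.naturality f
    simp only [Functor.comp_map, Functor.op_map, Functor.rightOp_map, Functor.map_comp, op_comp,
      Quiver.Hom.unop_op, Functor.id_map] at h1 h2 ⊢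
    rw [Category.assoc, ← h2, ← reassoc_of% h1]

lemma isIso_transCounit {C E : Type*} [Category* C] [Category* E] {U : C ⥤ C} {U' : E ⥤ E}
    {T : Cᵒᵖ ⥤ E} {T' : Eᵒᵖ ⥤ C} (α : T ⟶ U.op ⋙ T ⋙ U') (β : T.rightOp ⋙ T' ≅ 𝟭 C) (X : C)
    (h : IsIso (α.app (Opposite.op X))) : IsIso ((transCounit α β).app X) := by
  rw [transCounit]
  infer_instance

/-! ### The comparison of `Tr` with `Ωᵏ Tr Ωᵏ` -/

section

variable (A : Type u) [Ring A] [IsNoetherianRing A] (B : Type u) [Ring B] [IsNoetherianRing B]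
  (D : Type u) [AddCommGroup D] [Module A D] [Module B D] [SMulCommClass A B D]
  [Module.Finite B D] [Module.Projective B D]

/-- The natural transformation `Tr ⟶ Ωᵏ Tr Ωᵏ`. -/
def thetaPow : ∀ k : ℕ,
    trFunctor A B D ⟶ (syzPow A k).op ⋙ trFunctor A B D ⋙ syzPow B k
  | 0 => 𝟙 _
  | k + 1 => transStep (theta A B D) (thetaPow k) (syzPowComm B k)

lemma isIso_theta (X : FGModuleCat.{u} A) (h : EV A D X 1) :
    IsIso ((theta A B D).app (Opposite.op ((toStable A).obj X))) :=
  isIso_thetaHom B D X ((syzPres_syz X).ev_one_iff.1 h)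

/-- Step k uses `theta` at ΩᵏX, where Ext¹(ΩᵏX, D) = Extᵏ⁺¹(X, D). -/
lemma isIso_thetaPow (k : ℕ) (X : FGModuleCat.{u} A) (h : ∀ i < k, EV A D X (i + 1)) :
    IsIso ((thetaPow A B D k).app (Opposite.op ((toStable A).obj X))) := by
  induction k with
  | zero => exact inferInstanceAs (IsIso (𝟙 _))
  | succ k ih =>
    have h1 := ih fun i hi => h i (by omega)
    have h2 : IsIso ((theta A B D).app
        (Opposite.op ((syzPow A k).obj ((toStable A).obj X)))) := by
      rw [syzPow_obj]
      apply isIso_theta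
      rw [ev_nsyz_iff]
      exact h _ (by omega)
    exact isIso_transStep _ _ _ _ h1 h2

variable [SMulCommClass B A D] [IsEndRing A B D] [Module.Finite A D] [Module.Projective A D]

/-- The natural transformation from the composite of `Tr Ωᵏ` with itself to the identity. -/
def trSyzCounit (k : ℕ) :
    (trSyz A B D k).rightOp ⋙ trSyz B A D k ⟶ 𝟭 (StableCat A) :=
  transCounit (thetaPow A B D k) (trTrIso A B D)

lemma isIso_trSyzCounit (k : ℕ) (X : FGModuleCat.{u} A) (h : ∀ i < k, EV A D X (i + 1)) :
    IsIso ((trSyzCounit A B D k).app ((toStable A).obj X)) := by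
  exact isIso_transCounit _ _ _ (isIso_thetaPow A B D k X h)

end

/-! ### Dualities of subcategories given by `Tr Ωᵏ` -/

section Equivalence

variable {A : Type u} [Ring A] [IsNoetherianRing A] {B : Type u} [Ring B] [IsNoetherianRing B]
  {D : Type u} [AddCommGroup D] [Module A D] [Module B D] [SMulCommClass A B D]
  [SMulCommClass B A D] [IsEndRing A B D] [IsEndRing B A D]
  [Module.Finite A D] [Module.Projective A D] [Module.Finite B D] [Module.Projective B D]

/-- The functor `Tr Ωᵏ` between subcategories. -/
def trSyzLift (P : ObjectProperty (FGModuleCat.{u} A)) (P' : ObjectProperty (FGModuleCat.{u} B))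
    (k : ℕ) (h : ∀ M, P M → P' (tr B D (nsyz k M))) : (Stable P)ᵒᵖ ⥤ Stable P' :=
  (stableProp P').lift ((stableIncl P).op ⋙ trSyz A B D k) fun M => by
    have := h _ M.unop.property
    have e := syzPow_obj k M.unop.obj.as
    change P' (((trFunctor A B D).obj (Opposite.op ((syzPow A k).obj _))).as)
    -- The hypothesis concerns `nsyz`, the functor `syzPow`; they agree on objects by induction on
    -- k.
    exact e ▸ this

/-- The composite of `Tr Ωᵏ` with itself is the identity on modules with vanishing `Extⁱ(-, D)`
for `1 ≤ i ≤ k`. -/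
def trSyzLiftIso (P : ObjectProperty (FGModuleCat.{u} A))
    (P' : ObjectProperty (FGModuleCat.{u} B)) (k : ℕ) (h : ∀ M, P M → P' (tr B D (nsyz k M)))
    (h' : ∀ M, P' M → P (tr A D (nsyz k M))) (hP : ∀ M, P M → ∀ i < k, EV A D M (i + 1)) :
    (trSyzLift P P' k h).rightOp ⋙ trSyzLift P' P k h' ≅ 𝟭 (Stable P) :=
  Functor.fullyFaithfulCancelRight (stableIncl P) <|
    NatIso.ofComponents
      (fun M => @asIso _ _ _ _ ((trSyzCounit A B D k).app M.obj)
        (isIso_trSyzCounit A B D k M.obj.as (hP _ M.property)))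
      fun f => (trSyzCounit A B D k).naturality f.hom

/-- `Tr Ωᵏ` is a duality between subcategories of modules with vanishing `Extⁱ(-, D)` for
`1 ≤ i ≤ k`. -/
def trSyzEquiv (P : ObjectProperty (FGModuleCat.{u} A))
    (P' : ObjectProperty (FGModuleCat.{u} B)) (k : ℕ) (h : ∀ M, P M → P' (tr B D (nsyz k M)))
    (h' : ∀ M, P' M → P (tr A D (nsyz k M))) (hP : ∀ M, P M → ∀ i < k, EV A D M (i + 1))
    (hP' : ∀ M, P' M → ∀ i < k, EV B D M (i + 1)) : (Stable P)ᵒᵖ ≌ Stable P' :=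
  CategoryTheory.Equivalence.mk (trSyzLift P P' k h) (trSyzLift P' P k h').rightOp
    (NatIso.ofComponents (fun M => ((trSyzLiftIso P P' k h h' hP).app M.unop).op) fun f =>
      congrArg Quiver.Hom.op ((trSyzLiftIso P P' k h h' hP).hom.naturality f.unop).symm)
    (NatIso.ofComponents (fun M => (trSyzLiftIso P' P k h' h hP').app M) fun f =>
      (trSyzLiftIso P' P k h' h hP').hom.naturality f)

end Equivalence

/-! ### The transpose and `Ext` -/

section TrExt

variable {A : Type u} [Ring A] [IsNoetherianRing A] {B : Type u} [Ring B] [IsNoetherianRing B]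
  {D : Type u} [AddCommGroup D] [Module A D] [Module B D] [SMulCommClass A B D]
  [SMulCommClass B A D] [IsEndRing A B D] [IsEndRing B A D]
  [Module.Finite A D] [Module.Projective A D] [Module.Finite B D] [Module.Projective B D]

variable (B D) in
/-- The image of `Hom(P₀, D) → Hom(P₁, D)`. -/
abbrev dualImage (X : FGModuleCat.{u} A) : Submodule B (Cover (syz X) →ₗ[A] D) :=
  LinearMap.range (dualMap B D (presMap X))

lemma syzPres_dualImage (X : FGModuleCat.{u} A) :
    SyzPres (dualImage B D X).subtype (trPr B D X) where
  inj := Subtype.val_injective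
  exact := by
    intro φ
    rw [(trPres_tr B D X).exact' φ]
    exact ⟨fun h => ⟨⟨φ, h⟩, rfl⟩, by rintro ⟨y, rfl⟩; exact y.2⟩
  surj := (trPres_tr B D X).surj'

/-- Spliced with `syzPres_dualImage`, this makes X* a second syzygy of Tr X: 0 → X* → P₀* → P₁* → Tr
X → 0 is exact. -/
lemma syzPres_dualCover (X : FGModuleCat.{u} A) :
    SyzPres (dualMap B D (cover X)) (dualMap B D (presMap X)).rangeRestrict where
  inj φ ψ h := (LinearMap.cancel_right (cover_surjective X)).1 h
  exact := by
    intro φ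
    constructor
    · intro h
      obtain ⟨ψ, hψ⟩ := exists_desc_of_exact (exact_presMap X) (cover_surjective X) φ
        (congrArg Subtype.val h)
      exact ⟨ψ, hψ⟩
    · rintro ⟨ψ, rfl⟩
      apply Subtype.ext
      change (ψ ∘ₗ cover X) ∘ₗ presMap X = 0
      rw [LinearMap.comp_assoc, cover_comp_presMap, LinearMap.comp_zero]
  surj := LinearMap.surjective_rangeRestrict _

/-- The kernel of X → X** is Ext¹(Tr X, D), the obstruction to extending functionals from the image
I of P₀* → P₁* to P₁*. By biduality, functionals on I are elements p of P₀ whose class in X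
evaluates to zero, and the extendable ones come from P₁. -/
lemma ev_tr_one_iff (X : FGModuleCat.{u} A) :
    EV B D (tr B D X) 1 ↔ Function.Injective (evMap A B D X) := by
  rw [(syzPres_dualImage X).ev_one_iff]
  constructor
  · intro h
    rw [injective_iff_map_eq_zero]
    intro (x : X) hx
    obtain ⟨p, rfl⟩ := cover_surjective X x
    obtain ⟨φ, hφ⟩ := exists_desc_of_exact (syzPres_dualCover X).exact (syzPres_dualCover X).surj
      (evMap A B D (Cover X) p) (by ext f; exact LinearMap.congr_fun hx f)
    obtain ⟨ψ, rfl⟩ := h φ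
    obtain ⟨q, rfl⟩ := (evMap_bijective A B D (Cover (syz X))).2 ψ
    have : presMap X q = p := by
      apply (evMap_bijective A B D (Cover X)).1
      rw [← hφ]
      rfl
    rw [← this]
    exact LinearMap.congr_fun (cover_comp_presMap X) q
  · intro h φ
    obtain ⟨p, hp⟩ := (evMap_bijective A B D (Cover X)).2
      (φ ∘ₗ (dualMap B D (presMap X)).rangeRestrict)
    have h0 : cover X p = 0 := by
      apply h
      rw [map_zero]
      ext f
      have := LinearMap.congr_fun hp (f ∘ₗ cover X)
      rw [evMap_apply, LinearMap.comp_apply] at this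
      rw [evMap_apply, LinearMap.zero_apply, this]
      exact (congrArg φ (LinearMap.congr_fun
        (syzPres_dualCover X).exact.linearMap_comp_eq_zero f)).trans (map_zero φ)
    obtain ⟨q, rfl⟩ := (exact_presMap X p).1 h0
    refine ⟨evMap A B D _ q, ?_⟩
    rw [← LinearMap.cancel_right (syzPres_dualCover X).surj, ← hp]
    rfl

/-- Ext²(Tr X, D) obstructs extending functionals from X* to P₀*; by biduality the extendable ones
are the evaluations at elements of X. -/
lemma ev_tr_two_iff (X : FGModuleCat.{u} A) :
    EV B D (tr B D X) 2 ↔ Function.Surjective (evMap A B D X) := by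
  rw [(syzPres_dualImage X).ev_succ_iff 0, (syzPres_dualCover X).ev_one_iff]
  constructor
  · intro h φ
    obtain ⟨ψ, rfl⟩ := h φ
    obtain ⟨p, rfl⟩ := (evMap_bijective A B D (Cover X)).2 ψ
    exact ⟨cover X p, rfl⟩
  · intro h φ
    obtain ⟨x, rfl⟩ := h φ
    obtain ⟨p, rfl⟩ := cover_surjective X x
    exact ⟨evMap A B D _ p, rfl⟩

lemma ev_tr_add_three_iff (X : FGModuleCat.{u} A) (i : ℕ) :
    EV B D (tr B D X) (i + 3) ↔ EV B D (X →ₗ[A] D) (i + 1) := by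
  rw [(syzPres_dualImage X).ev_succ_iff (i + 1), (syzPres_dualCover X).ev_succ_iff i]

/-- The totally reflexive modules are those with vanishing `Extⁱ(M, D)` and `Extⁱ(Tr M, D)` for
all `i ≥ 1`. -/
lemma totReflProp_eq_gProp : totReflProp A B D = gProp A B D ⊤ (⊤ + 1) := by
  funext M
  apply propext
  have h : Function.Bijective (fun (x : M) => (LinearMap.applyₗ' B x : (M →ₗ[A] D) →ₗ[B] D)) ↔
      Function.Injective (evMap A B D M) ∧ Function.Surjective (evMap A B D M) := Iff.rfl
  simp only [totReflProp, gProp, top_add, le_top, forall_const]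
  rw [h, ← ev_tr_one_iff, ← ev_tr_two_iff]
  constructor
  · rintro ⟨⟨h1, h2⟩, h3, h4⟩
    refine ⟨h3, fun j hj => ?_⟩
    match j, hj with
    | 1, _ => exact h1
    | 2, _ => exact h2
    | j + 3, _ => exact (ev_tr_add_three_iff M j).2 (h4 (j + 1) (by omega))
  · rintro ⟨h3, h4⟩
    refine ⟨⟨h4 1 le_rfl, h4 2 (by omega)⟩, h3, fun i hi => ?_⟩
    obtain ⟨j, rfl⟩ := Nat.exists_eq_add_of_le' hi
    exact (ev_tr_add_three_iff M j).1 (h4 _ (by omega))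

/-- `Ext¹(Tr X, D)` vanishes for syzygies `X`. -/
lemma ev_tr_syz_one (X : FGModuleCat.{u} A) : EV B D (tr B D (syz X)) 1 := by
  rw [ev_tr_one_iff, injective_iff_map_eq_zero]
  intro x hx
  apply syzIncl_injective X
  rw [map_zero]
  apply (evMap_bijective A B D (Cover X)).1
  rw [map_zero]
  ext φ
  exact LinearMap.congr_fun hx (φ ∘ₗ syzIncl X)

lemma stIso_trTr (X : FGModuleCat.{u} A) : StIso (tr A D (tr B D X)) X :=
  ⟨(trTrIso A B D).app ((toStable A).obj X)⟩

lemma stIso_theta (X : FGModuleCat.{u} A) (h : EV A D X 1) :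
    StIso (tr B D X) (syz (tr B D (syz X))) := by
  have := isIso_thetaHom B D X ((syzPres_syz X).ev_one_iff.1 h)
  exact ⟨asIso ((toStable B).map (thetaHom B D X))⟩

lemma stIso_thetaPow (k : ℕ) (X : FGModuleCat.{u} A) (h : ∀ i < k, EV A D X (i + 1)) :
    StIso (tr B D X) (nsyz k (tr B D (nsyz k X))) := by
  have := isIso_thetaPow A B D k X h
  have e := asIso ((thetaPow A B D k).app (Opposite.op ((toStable A).obj X)))
  have e' : (toStable B).obj (tr B D X) ≅ (syzPow B k).obj ((trFunctor A B D).obj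
    (Opposite.op ((syzPow A k).obj ((toStable A).obj X)))) := e
  rw [syzPow_obj] at e'
  have e'' : (toStable B).obj (tr B D X) ≅
    (syzPow B k).obj ((toStable B).obj (tr B D (nsyz k X))) := e'
  rw [syzPow_obj] at e''
  exact ⟨e''⟩

lemma nsyz_add (i j : ℕ) (X : FGModuleCat.{u} A) : nsyz (i + j) X = nsyz i (nsyz j X) := by
  induction i with
  | zero => rw [Nat.zero_add]; rfl
  | succ i ih => rw [Nat.succ_add]; exact congrArg syz ih

/-- `Extⁱ(Tr Ωᵏ X, D)` vanishes for `1 ≤ i ≤ k` if `Extⁱ(X, D)` does. -/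
lemma ev_tr_nsyz (k : ℕ) (X : FGModuleCat.{u} A) (h : ∀ i < k, EV A D X (i + 1)) {i : ℕ}
    (hi : i < k) : EV B D (tr B D (nsyz k X)) (i + 1) := by
  -- With W = Ωʲ⁺¹X, Extⁱ⁺¹(Tr ΩⁱW, D) = Ext¹(Ωⁱ Tr ΩⁱW, D) = Ext¹(Tr W, D), which vanishes because
  -- W is a syzygy.
  obtain ⟨j, rfl⟩ : ∃ j, k = i + (j + 1) := ⟨k - i - 1, by omega⟩
  rw [← Nat.zero_add i, ← ev_nsyz_iff, nsyz_add, Nat.zero_add]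
  refine StIso.ev A (stIso_thetaPow i (nsyz (j + 1) X) fun l hl => ?_) (ev_tr_syz_one (nsyz j X))
  rw [ev_nsyz_iff]
  exact h _ (by omega)

/-! ### Closure properties of the subcategories -/

lemma StIso.gProp {m n : ℕ∞} {M N : FGModuleCat.{u} A} (h : StIso M N)
    (hM : gProp A B D m n M) : gProp A B D m n N := by
  constructor
  · intro i hi him
    obtain ⟨j, rfl⟩ := Nat.exists_eq_add_of_le' hi
    exact h.ev B (hM.1 _ hi him)
  · intro i hi him
    obtain ⟨j, rfl⟩ := Nat.exists_eq_add_of_le' hi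
    exact (h.map_tr (B := B) (D := D)).ev A (hM.2 _ hi him)

/-- Extⁱ(Ω Tr Z, D) = Extⁱ⁺¹(Tr Z, D) turns the bound m + 1 into m. In the other direction, Ext¹(Tr
Ω Tr Z, D) = 0 for any syzygy, and in degree j + 1 with j ≥ 1 one finds Extʲ(Ω Tr Ω Tr Z, D) =
Extʲ(Z, D), turning m into m + 1. -/
lemma gProp_syz_tr {m : ℕ∞} {Z : FGModuleCat.{u} A} (h : gProp A B D m (m + 1) Z) :
    gProp B A D m (m + 1) (syz (tr B D Z)) := by
  constructor
  · intro i hi him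
    obtain ⟨j, rfl⟩ := Nat.exists_eq_add_of_le' hi
    refine (ev_syz_iff (tr B D Z) j).2 (h.2 (j + 2) (by omega) ?_)
    push_cast at him ⊢
    rw [show (2 : ℕ∞) = 1 + 1 from one_add_one_eq_two.symm, ← add_assoc]
    gcongr
  · intro i hi him
    match i, hi with
    | 1, _ => exact ev_tr_syz_one _
    | n + 2, _ =>
      -- Z ≅ Tr Tr Z ≅ Ω Tr Ω Tr Z stably; the second isomorphism needs Ext¹(Tr Z, D) = 0.
      refine (ev_syz_iff _ n).1 (StIso.ev B (StIso.trans (stIso_trTr Z).symm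
        (stIso_theta (tr B D Z) (h.2 1 le_rfl ?_))) (h.1 (n + 1) (by omega) ?_))
      · simp
      · push_cast at him ⊢
        rw [show (2 : ℕ∞) = 1 + 1 from one_add_one_eq_two.symm, ← add_assoc] at him
        exact (ENat.add_le_add_iff_right ENat.one_ne_top).1 him

end TrExt

/-! ### Spherical modules and extensions by modules of large grade -/

section Star

variable {A : Type u} [Ring A] [IsNoetherianRing A] {B : Type u} [Ring B] [IsNoetherianRing B]
  {D : Type u} [AddCommGroup D] [Module A D] [Module B D] [SMulCommClass A B D]
  [SMulCommClass B A D] [IsEndRing A B D] [IsEndRing B A D]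
  [Module.Finite A D] [Module.Projective A D] [Module.Finite B D] [Module.Projective B D]

variable (B D) in
/-- If `g : N → Z` is surjective and induces an isomorphism `Hom(Z, D) → Hom(N, D)`, then
`Ω Tr N` and `Ω Tr Z` are stably isomorphic. -/
lemma stIso_syz_tr {N Z : FGModuleCat.{u} A} (g : N →ₗ[A] Z) (hg : Function.Surjective g)
    (h : ∀ φ : N →ₗ[A] D, ∃ ψ : Z →ₗ[A] D, ψ ∘ₗ g = φ) :
    StIso (syz (tr B D N)) (syz (tr B D Z)) := by
  -- Z is presented with the cover P₀ of N, so that both transposes start from the same P₀*.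
  let K := FGModuleCat.of A (LinearMap.ker (g ∘ₗ cover N))
  let d : Cover K →ₗ[A] Cover N := (LinearMap.ker (g ∘ₗ cover N)).subtype ∘ₗ cover K
  let I := LinearMap.range (dualMap B D d)
  let T := FGModuleCat.of B ((Cover K →ₗ[A] D) ⧸ I)
  let p : (Cover K →ₗ[A] D) →ₗ[B] T := I.mkQ
  have hp : Function.Surjective p := Submodule.mkQ_surjective _
  have hd : (g ∘ₗ cover N) ∘ₗ d = 0 := LinearMap.ext fun x => (cover K x).2
  have H : TrPres B D d (g ∘ₗ cover N) p :=
    { exact := by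
        intro x
        constructor
        · intro hx
          obtain ⟨y, hy⟩ := cover_surjective K ⟨x, hx⟩
          exact ⟨y, congrArg Subtype.val hy⟩
        · rintro ⟨y, rfl⟩
          exact LinearMap.congr_fun hd y
      surj := hg.comp (cover_surjective N)
      exact' := fun _ => Submodule.Quotient.mk_eq_zero _
      surj' := hp }
  have HI : SyzPres I.subtype p :=
    { inj := Subtype.val_injective
      exact := by
        intro φ
        rw [H.exact' φ]
        exact ⟨fun h => ⟨⟨φ, h⟩, rfl⟩, by rintro ⟨y, rfl⟩; exact y.2⟩
      surj := hp }
  -- The two kernels in P₀* are N* and Z*, which coincide by hypothesis; so the two images are the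
  -- same quotient of P₀*.
  have hker : LinearMap.ker (dualMap B D (presMap N)) = LinearMap.ker (dualMap B D d) := by
    ext φ
    constructor
    · intro hφ
      obtain ⟨ψ, rfl⟩ := exists_desc_of_exact (exact_presMap N) (cover_surjective N) φ hφ
      obtain ⟨χ, rfl⟩ := h ψ
      change χ ∘ₗ ((g ∘ₗ cover N) ∘ₗ d) = 0
      rw [hd, LinearMap.comp_zero]
    · intro hφ
      obtain ⟨χ, rfl⟩ := exists_desc_of_exact H.exact H.surj φ hφ
      change (χ ∘ₗ g ∘ₗ cover N) ∘ₗ presMap N = 0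
      rw [LinearMap.comp_assoc, LinearMap.comp_assoc, cover_comp_presMap, LinearMap.comp_zero,
        LinearMap.comp_zero]
  have e : dualImage B D N ≃ₗ[B] I :=
    (LinearMap.quotKerEquivRange _).symm.trans
      ((Submodule.quotEquivOfEq _ _ hker).trans (LinearMap.quotKerEquivRange _))
  have s1 : StIso (FGModuleCat.of B (dualImage B D N)) (syz (tr B D N)) :=
    StIso.of_syzPres (K := FGModuleCat.of B (dualImage B D N)) (syzPres_dualImage N)
  have s2 : StIso (FGModuleCat.of B I) (syz T) :=
    StIso.of_syzPres (K := FGModuleCat.of B I) HI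
  have s3 : StIso (FGModuleCat.of B (dualImage B D N)) (FGModuleCat.of B I) :=
    StIso.of_linearEquiv e
  have s4 : StIso T (tr B D Z) := StIso.of_trPres H
  exact s1.symm.trans (s3.trans (s2.trans s4.map_syz))

lemma ev_of_starProp {X' : ObjectProperty (FGModuleCat.{u} A)} {n : ℕ}
    (hX : ∀ M, X' M → ∀ i < n, EV A D M (i + 1)) {N : FGModuleCat.{u} A}
    (hN : starProp (grdProp A D (n + 1)) X' N) : ∀ i < n, EV A D N (i + 1) := by
  obtain ⟨L, Z, f, g, hL, hZ, hf, hfg, hg⟩ := hN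
  intro i hi
  exact SyzPres.ev_mid ⟨hf, hfg, hg⟩ (grdProp_iff.1 hL _ (by omega)) (hX Z hZ i hi)

/-- `Tr Ωᵏ` sends extensions of modules in `X'` by modules of grade at least `k + 1` to
`(k + 1)`-`X`-spherical modules. -/
lemma sphProp_tr_nsyz {X : ObjectProperty (FGModuleCat.{u} B)}
    {X' : ObjectProperty (FGModuleCat.{u} A)} {k : ℕ}
    (hX : ∀ M N, StIso M N → X M → X N) (hX' : ∀ M, X' M → X (syz (tr B D M)))
    (hE : ∀ M, X' M → ∀ i < k, EV A D M (i + 1)) (N : FGModuleCat.{u} A)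
    (hN : starProp (grdProp A D (k + 1)) X' N) :
    sphProp B D (k + 1) X (tr B D (nsyz k N)) := by
  have hG := ev_of_starProp hE hN
  obtain ⟨L, Z, f, g, hL, hZ, hf, hfg, hg⟩ := hN
  constructor
  · intro i hi hik
    obtain ⟨j, rfl⟩ := Nat.exists_eq_add_of_le' hi
    exact ev_tr_nsyz k N hG (by omega)
  · have s1 := stIso_syz_tr B D g hg (by
      intro φ
      refine exists_desc_of_exact hfg hg φ ?_
      exact ev_zero_iff.1 (grdProp_iff.1 hL 0 (by omega)) _)
    have s2 := (stIso_thetaPow (B := B) (D := D) k N hG).map_syz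
    -- Ω Tr Z ≅ Ω Tr N ≅ Ωᵏ⁺¹ Tr ΩᵏN stably.
    exact hX _ _ (s1.symm.trans s2) (hX' Z hZ)

/-- `Tr Ωᵏ` sends `(k + 1)`-`X`-spherical modules to extensions of modules in `X'` by modules of
grade at least `k + 1`. -/
lemma starProp_tr_nsyz {X : ObjectProperty (FGModuleCat.{u} A)}
    {X' : ObjectProperty (FGModuleCat.{u} B)} {k : ℕ}
    (hX' : ∀ M N, StIso M N → X' M → X' N) (hX : ∀ M, X M → X' (syz (tr B D M)))
    (hE : ∀ M, X' M → ∀ i < k + 1, EV B D M (i + 1)) (M : FGModuleCat.{u} A)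
    (hM : sphProp A D (k + 1) X M) :
    starProp (grdProp B D (k + 1)) X' (tr B D (nsyz k M)) := by
  have hG : ∀ i < k, EV A D M (i + 1) := fun i hi => hM.1 (i + 1) (by omega) (by omega)
  have hY : X (syz (nsyz k M)) := hM.2
  have hT : ∀ i < k, EV B D (tr B D (nsyz k M)) (i + 1) := fun i hi => ev_tr_nsyz k M hG hi
  generalize nsyz k M = Y at hY hT ⊢
  -- The kernel of δ is Ext¹(Y, D); its image is a syzygy of Tr ΩY.
  let δ := trDelta B D Y
  let L := FGModuleCat.of B (LinearMap.ker δ)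
  let Z := FGModuleCat.of B (LinearMap.range δ)
  have H : SyzPres (K := L) (N := Z) (LinearMap.ker δ).subtype δ.rangeRestrict :=
    { inj := Subtype.val_injective
      exact := by
        intro x
        constructor
        · intro hx
          exact ⟨⟨x, congrArg Subtype.val hx⟩, rfl⟩
        · rintro ⟨y, rfl⟩
          exact Subtype.ext y.2
      surj := LinearMap.surjective_rangeRestrict _ }
  have HZ : SyzPres (K := Z) (LinearMap.range δ).subtype (trPr B D (syz Y)) :=
    { inj := Subtype.val_injective
      exact := by
        intro x
        rw [exact_trDelta B D Y x]
        exact ⟨fun h => ⟨⟨x, h⟩, rfl⟩, by rintro ⟨y, rfl⟩; exact y.2⟩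
      surj := (trPres_tr B D (syz Y)).surj' }
  have hZ : X' Z := hX' _ _ (StIso.of_syzPres HZ).symm (hX _ hY)
  refine ⟨L, Z, (LinearMap.ker δ).subtype, δ.rangeRestrict, grdProp_iff.2 fun i hi => ?_, hZ,
    H.inj, H.exact, H.surj⟩
  cases i with
  -- For i + 1 = k this needs Extᵏ⁺¹(Z, D) = 0, whence the range i < k + 1 in `hE`.
  | succ i => exact H.ev_left (hT i (by omega)) (hE Z hZ (i + 1) (by omega))
  | zero =>
    refine ev_zero_iff.2 fun φ => ?_
    -- Since Ext¹(Z, D) = 0, a functional on L extends to Tr Y. Pulled back to P₁*, it is evaluation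
    -- at some q in P₁.
    obtain ⟨ψ, rfl⟩ := (H.delta_eq_zero_iff φ).1 (ev_iff.1 (hE Z hZ 0 (by omega)) _)
    obtain ⟨q, hq⟩ := (evMap_bijective A B D (Cover (syz Y))).2 (ψ ∘ₗ trPr B D Y)
    have h0 : presMap Y q = 0 := by
      apply (evMap_bijective A B D (Cover Y)).1
      rw [map_zero]
      ext χ
      have h1 := LinearMap.congr_fun hq (χ ∘ₗ presMap Y)
      have h2 : trPr B D Y (χ ∘ₗ presMap Y) = 0 := trProj_eq_zero B D Y χ
      rw [LinearMap.comp_apply, h2, map_zero] at h1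
      exact h1
    -- As q dies in P₀, it comes from r in P₂; the classes in L are those of functionals vanishing
    -- on the image of P₂.
    obtain ⟨r, rfl⟩ := (exact_presMap (syz Y) q).1 (syzIncl_injective Y (h0.trans
      (map_zero (syzIncl Y)).symm))
    ext x
    obtain ⟨x, hx⟩ := x
    obtain ⟨χ, rfl⟩ := (trPres_tr B D Y).surj' x
    have h1 := LinearMap.congr_fun hq χ
    have h2 : χ ∘ₗ presMap (syz Y) = 0 := (trDelta_trPr B D Y χ).symm.trans hx
    exact h1.symm.trans (LinearMap.congr_fun h2 r)

/-- The duality `Tr Ωᵏ` between `(k + 1)`-`X`-spherical modules and extensions of modules in `X'`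
by modules of grade at least `k + 1`. -/
theorem exists_equiv_sph_star {X : ObjectProperty (FGModuleCat.{u} A)}
    {X' : ObjectProperty (FGModuleCat.{u} B)} (k : ℕ)
    (hX : ∀ M N, StIso M N → X M → X N) (hX' : ∀ M N, StIso M N → X' M → X' N)
    (h : ∀ M, X M → X' (syz (tr B D M))) (h' : ∀ M, X' M → X (syz (tr A D M)))
    (hE : ∀ M, X' M → ∀ i < k + 1, EV B D M (i + 1)) :
    ∃ E : (Stable (sphProp A D (k + 1) X))ᵒᵖ ≌ Stable (starProp (grdProp B D (k + 1)) X'),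
      Nonempty (E.functor ⋙ stableIncl (starProp (grdProp B D (k + 1)) X') ≅
        (stableIncl (sphProp A D (k + 1) X)).op ⋙ trSyz A B D k) ∧
      Nonempty (E.inverse ⋙ (stableIncl (sphProp A D (k + 1) X)).op ≅
        stableIncl (starProp (grdProp B D (k + 1)) X') ⋙ (trSyz B A D k).rightOp) :=
  ⟨trSyzEquiv _ _ k (starProp_tr_nsyz hX' h hE)
    (sphProp_tr_nsyz hX h' fun M hM i hi => hE M hM i (by omega))
    (fun M hM i hi => hM.1 (i + 1) (by omega) (by omega))
    (fun M hM => ev_of_starProp (fun M hM i hi => hE M hM i (by omega)) hM),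
    ⟨Iso.refl _⟩, ⟨Iso.refl _⟩⟩

end Star

open CategoryTheory.Abelian

/-! ### Dimension shifting for `Ext` -/

section Shift

variable {A : Type u} [Ring A] [IsNoetherianRing A]

/-- The class in `Ext¹(X, ΩX)` of the chosen cover of `X`. -/
def syzClass (X : FGModuleCat.{u} A) : Ext.{u} X.obj (syz X).obj 1 :=
  (syzPres_syz X).shortExact.extClass

lemma syzClass_natural {X Y : FGModuleCat.{u} A} (f : X ⟶ Y) :
    (syzClass X).comp (Ext.mk₀ (syzMap f).hom) (add_zero 1) =
      (Ext.mk₀ f.hom).comp (syzClass Y) (zero_add 1) :=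
  ShortComplex.ShortExact.extClass_naturality (syzPres_syz X).shortExact
    (syzPres_syz Y).shortExact
    (ShortComplex.homMk (syzMap f).hom (ModuleCat.ofHom (coverMap f)) f.hom
      (ModuleCat.hom_ext (syzMap_spec f)) (ModuleCat.hom_ext (coverMap_spec f)))

variable (B : Type u) [Ring B]
  (D : Type u) [AddCommGroup D] [Module A D] [Module B D] [SMulCommClass A B D]

/-- The connecting homomorphism `Extⁿ(ΩX, D) → Extⁿ⁺¹(X, D)`. -/
def extShift (n : ℕ) (X : FGModuleCat.{u} A) :
    extObj A B D n (syz X).obj ⟶ extObj A B D (n + 1) X.obj :=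
  letI := extModule A B D (syz X).obj n
  letI := extModule A B D X.obj (n + 1)
  ModuleCat.ofHom
    { toFun := fun x : Ext.{u} (syz X).obj (ModuleCat.of A D) n =>
        ((syzClass X).comp x (add_comm 1 n) : Ext.{u} X.obj (ModuleCat.of A D) (n + 1))
      map_add' := fun _ _ => Ext.comp_add _ _ _ _
      map_smul' := fun _ _ => (Ext.comp_assoc_of_third_deg_zero _ _ _ _).symm }

lemma extShift_natural (n : ℕ) {X Y : FGModuleCat.{u} A} (f : X ⟶ Y) :
    extMap A B D n (syzMap f).hom ≫ extShift B D n X =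
      extShift B D n Y ≫ extMap A B D (n + 1) f.hom := by
  refine ModuleCat.hom_ext (LinearMap.ext fun x => ?_)
  let x' : Ext.{u} (syz Y).obj (ModuleCat.of A D) n := x
  change (syzClass X).comp ((Ext.mk₀ (syzMap f).hom).comp x' (zero_add n)) (add_comm 1 n) =
    (Ext.mk₀ f.hom).comp ((syzClass Y).comp x' (add_comm 1 n)) (zero_add (n + 1))
  rw [← Ext.comp_assoc _ _ _ (add_zero 1) (zero_add n) (by omega), syzClass_natural,
    Ext.comp_assoc _ _ _ (zero_add 1) (add_comm 1 n) (by omega)]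

lemma extShift_bijective (n : ℕ) (X : FGModuleCat.{u} A) :
    Function.Bijective (extShift B D (n + 1) X).hom := by
  constructor
  · rw [injective_iff_map_eq_zero]
    intro x hx
    obtain ⟨y, hy⟩ := Ext.contravariant_sequence_exact₁ (syzPres_syz X).shortExact _ x
      (add_comm 1 (n + 1)) hx
    rw [ev_iff.1 (ev_of_projective (D := D) (P := Cover X) n) y, Ext.comp_zero] at hy
    exact hy.symm
  · intro x
    obtain ⟨y, hy⟩ := Ext.contravariant_sequence_exact₃ (syzPres_syz X).shortExact _ x
      (ev_iff.1 (ev_of_projective (D := D) (P := Cover X) (n + 1)) _) (add_comm 1 (n + 1))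
    exact ⟨y, hy⟩

variable (A) in
/-- The natural isomorphism `Extⁿ⁺¹(Ω -, D) ≅ Extⁿ⁺²(-, D)`. -/
def extShiftIso (n : ℕ) : (syzFunctor A).op ⋙ stableExt A B D (n + 1) (by omega) ≅
    stableExt A B D (n + 2) (by omega) :=
  NatIso.ofComponents
    (fun X => (LinearEquiv.ofBijective (extShift B D (n + 1) X.unop.as).hom
      (extShift_bijective B D n X.unop.as)).toModuleIso) (by
    rintro ⟨Y⟩ ⟨X⟩ f
    obtain ⟨f, rfl⟩ : ∃ g : X ⟶ Y, g.op = f := ⟨f.unop, rfl⟩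
    obtain ⟨f, rfl⟩ := (toStable A).map_surjective f
    exact extShift_natural B D (n + 1) f)

variable (A) in
/-- The natural isomorphism `Ext¹(Ωᵏ -, D) ≅ Extᵏ⁺¹(-, D)`. -/
def extShiftPowIso : ∀ k : ℕ, (syzPow A k).op ⋙ stableExt A B D 1 le_rfl ≅
    stableExt A B D (k + 1) (by omega)
  | 0 => Iso.refl _
  | k + 1 => Functor.isoWhiskerRight (NatIso.op (syzPowComm A k)) (stableExt A B D 1 le_rfl) ≪≫
      Functor.isoWhiskerLeft (syzFunctor A).op (extShiftPowIso k) ≪≫ extShiftIso A B D k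

/-- The connecting homomorphism `Hom(ΩX, D) → Ext¹(X, D)`. -/
def deltaLin (X : FGModuleCat.{u} A) : (syz X →ₗ[A] D) →ₗ[B] extObj A B D 1 X.obj where
  toFun φ := (syzPres_syz X).delta φ
  map_add' φ ψ := by
    change (syzClass X).comp (Ext.mk₀ (ModuleCat.ofHom φ + ModuleCat.ofHom ψ)) _ = _
    rw [Ext.mk₀_add, Ext.comp_add]
    rfl
  map_smul' b φ := by
    let g : (syz X).obj ⟶ ModuleCat.of A D := ModuleCat.ofHom φ
    change (syzClass X).comp (Ext.mk₀ (g ≫ actB A D b)) (add_zero 1) =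
      ((syzClass X).comp (Ext.mk₀ g) (add_zero 1)).comp (Ext.mk₀ (actB A D b)) (add_zero 1)
    rw [← Ext.mk₀_comp_mk₀, Ext.comp_assoc_of_third_deg_zero]

lemma deltaLin_surjective (X : FGModuleCat.{u} A) : Function.Surjective (deltaLin B D X) :=
  (syzPres_syz X).delta_surjective

lemma exact_deltaLin (X : FGModuleCat.{u} A) :
    Function.Exact (dualMap B D (syzIncl X)) (deltaLin B D X) :=
  fun φ => (syzPres_syz X).delta_eq_zero_iff φ

lemma extMap_deltaLin {X Y : FGModuleCat.{u} A} (f : X ⟶ Y) (φ : syz Y →ₗ[A] D) :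
    (extMap A B D 1 f.hom).hom (deltaLin B D Y φ) =
      deltaLin B D X (φ ∘ₗ (syzMap f).hom.hom) := by
  let g : (syz Y).obj ⟶ ModuleCat.of A D := ModuleCat.ofHom φ
  change (Ext.mk₀ f.hom).comp ((syzClass Y).comp (Ext.mk₀ g) (add_zero 1)) (zero_add 1) =
    (syzClass X).comp (Ext.mk₀ ((syzMap f).hom ≫ g)) (add_zero 1)
  rw [← Ext.mk₀_comp_mk₀, ← Ext.comp_assoc_of_third_deg_zero, ← Ext.comp_assoc_of_third_deg_zero,
    syzClass_natural]

variable [IsNoetherianRing B] [Module.Finite B D] [Module.Projective B D]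

/-- Ext¹(X, D) is a quotient of (ΩX)*, which embeds in P₁*, and B is noetherian. -/
lemma extObj_one_finite (X : FGModuleCat.{u} A) : Module.Finite B (extObj A B D 1 X.obj) := by
  have h1 : Function.Injective (dualMap B D (cover (syz X))) := fun φ ψ h =>
    (LinearMap.cancel_right (cover_surjective (syz X))).1 h
  have := dual_finite (A := A) B D (Cover (syz X))
  have := Module.Finite.of_injective _ h1
  exact Module.Finite.of_surjective _ (deltaLin_surjective B D X)

variable (A) in
/-- The functor `Extᵏ⁺¹(-, D)` to finitely generated modules. -/
def extFG (k : ℕ) : (StableCat A)ᵒᵖ ⥤ FGModuleCat.{u} B :=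
  (ModuleCat.isFG B).lift (stableExt A B D (k + 1) (by omega)) fun X => by
    -- Dimension shifting reduces finiteness to Ext¹(ΩᵏX, D).
    have : Module.Finite B (((syzPow A k).op ⋙ stableExt A B D 1 le_rfl).obj X) :=
      extObj_one_finite B D ((syzPow A k).obj X.unop).as
    exact Module.Finite.equiv ((extShiftPowIso A B D k).app X).toLinearEquiv

variable (A) in
/-- The natural isomorphism `Ext¹(Ωᵏ -, D) ≅ Extᵏ⁺¹(-, D)`, with values in finitely generated
modules. -/
def extFGIso (k : ℕ) : (syzPow A k).op ⋙ extFG A B D 0 ≅ extFG A B D k :=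
  Functor.fullyFaithfulCancelRight (ModuleCat.isFG B).ι (extShiftPowIso A B D k)

/-! ### The comparison of `Ext¹` with the transpose -/

/-- The finitely generated module `Ext¹(X, D)`. -/
abbrev extOne (X : FGModuleCat.{u} A) : FGModuleCat.{u} B :=
  (extFG A B D 0).obj (Opposite.op ((toStable A).obj X))

/-- The projection `Hom(ΩX, D) → Ext¹(X, D)`. -/
def extPr (X : FGModuleCat.{u} A) : (syz X →ₗ[A] D) →ₗ[B] extOne B D X := deltaLin B D X

lemma extPr_surjective (X : FGModuleCat.{u} A) : Function.Surjective (extPr B D X) :=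
  deltaLin_surjective B D X

/-- Ext¹(X, D) is the cokernel of P₀* → (ΩX)* and Tr X that of P₀* → P₁*; the cover P₁ → ΩX compares
them. -/
lemma exists_extOneToTr (X : FGModuleCat.{u} A) : ∃ t : extOne B D X →ₗ[B] tr B D X,
    t ∘ₗ extPr B D X = trPr B D X ∘ₗ dualMap B D (cover (syz X)) :=
  exists_desc_of_exact (exact_deltaLin B D X) (deltaLin_surjective B D X) _ (by
    ext φ
    exact trProj_eq_zero B D X φ)

/-- The comparison of `Ext¹(X, D)` with `Tr X`. -/
def extOneToTr (X : FGModuleCat.{u} A) : extOne B D X ⟶ tr B D X :=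
  fgHom (exists_extOneToTr B D X).choose

lemma extOneToTr_extPr (X : FGModuleCat.{u} A) (φ : syz X →ₗ[A] D) :
    (extOneToTr B D X).hom.hom (extPr B D X φ) = trPr B D X (φ ∘ₗ cover (syz X)) :=
  LinearMap.congr_fun (exists_extOneToTr B D X).choose_spec φ

/-- The square commutes before passing to the stable category, since the chosen lifts defining Tr f
cover the chosen Ωf. -/
lemma extOneToTr_natural {X Y : FGModuleCat.{u} A} (f : X ⟶ Y) :
    (extFG A B D 0).map ((toStable A).map f).op ≫ extOneToTr B D X =
      extOneToTr B D Y ≫ trHom (B := B) (D := D) f := by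
  refine ObjectProperty.hom_ext _ (ModuleCat.hom_ext ?_)
  refine (LinearMap.cancel_right (extPr_surjective B D Y)).1 ?_
  ext1 φ
  have h1 : ((extFG A B D 0).map ((toStable A).map f).op).hom.hom (extPr B D Y φ) =
    extPr B D X (φ ∘ₗ (syzMap f).hom.hom) := extMap_deltaLin B D f φ
  change (extOneToTr B D X).hom.hom
      (((extFG A B D 0).map ((toStable A).map f).op).hom.hom (extPr B D Y φ)) =
    (trHom (B := B) (D := D) f).hom.hom ((extOneToTr B D Y).hom.hom (extPr B D Y φ))
  rw [h1, extOneToTr_extPr, extOneToTr_extPr, trHom_trPr, LinearMap.comp_assoc,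
    LinearMap.comp_assoc, coverMap_spec]

/-- When ΩX is projective, 0 → ΩX → P₀ → X → 0 is a projective presentation, so Ext¹(X, D) is one of
the transposes of X. -/
lemma trPres_ext (X : FGModuleCat.{u} A) :
    TrPres B D (syzIncl X) (cover X) (extPr B D X) where
  exact := (syzPres_syz X).exact
  surj := cover_surjective X
  exact' := exact_deltaLin B D X
  surj' := deltaLin_surjective B D X

lemma isIso_extOneToTr (X : FGModuleCat.{u} A) (h : Module.Projective A (syz X)) :
    IsIso ((toStable B).map (extOneToTr B D X)) :=
  TrRel.isIso (trPres_tr B D X) (trPres_ext B D X)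
    ⟨LinearMap.id, cover (syz X), rfl, rfl, (exists_extOneToTr B D X).choose_spec⟩

variable (A) in
/-- The natural transformation from `Ext¹(-, D)` to `Tr`. -/
def extOneTrans : extFG A B D 0 ⋙ toStable B ⟶ trFunctor A B D where
  app X := (toStable B).map (extOneToTr B D X.unop.as)
  naturality := by
    rintro ⟨Y⟩ ⟨X⟩ f
    obtain ⟨f, rfl⟩ : ∃ g : X ⟶ Y, g.op = f := ⟨f.unop, rfl⟩
    obtain ⟨f, rfl⟩ := (toStable A).map_surjective f
    have h := congrArg (toStable B).map (extOneToTr_natural B D f)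
    rw [(toStable B).map_comp, (toStable B).map_comp] at h
    exact h

end Shift

/-! ### Spherical modules and modules of large grade -/

section Projective

variable {A : Type u} [Ring A]

/-- If f and g are stably inverse, fg − 1 = ba with b, a through a projective Q, so N is a direct
summand of M ⊕ Q. -/
lemma StIso.projective {M N : FGModuleCat.{u} A} (h : StIso M N) (hM : projProp A M) :
    projProp A N := by
  obtain ⟨f, hf⟩ := (toStable A).map_surjective h.some.hom
  obtain ⟨g, hg⟩ := (toStable A).map_surjective h.some.inv
  have e : (toStable A).map (g ≫ f) = (toStable A).map (𝟙 N) := by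
    rw [(toStable A).map_comp, hf, hg, Iso.inv_hom_id, (toStable A).map_id]
  obtain ⟨Q, hQ, a, b, hab⟩ := (CategoryTheory.Quotient.functor_map_eq_iff _ _ _).1 e
  have : Module.Projective A M := hM
  refine Module.Projective.of_split (g.hom.hom.prod (-a : N →ₗ[A] Q)) (f.hom.hom.coprod b) ?_
  ext x
  have := LinearMap.congr_fun hab x
  change f.hom.hom (g.hom.hom x) - x = b (a x) at this
  simp [← this]

variable [IsNoetherianRing A] {B : Type u} [Ring B] [IsNoetherianRing B]
  {D : Type u} [AddCommGroup D] [Module A D] [Module B D] [SMulCommClass A B D]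
  [Module.Finite B D] [Module.Projective B D]

/-- The presentation 0 → M → M shows that Tr M, hence Ω Tr M, is stably zero. -/
lemma projective_syz_tr {M : FGModuleCat.{u} A} (h : projProp A M) :
    projProp B (syz (tr B D M)) := by
  have : Module.Projective A M := h
  let O := FGModuleCat.of B PUnit.{u + 1}
  have s1 : StIso O (tr B D M) := by
    refine StIso.of_trPres (P₁ := PUnit.{u + 1}) (P₀ := M) (d := 0) (π := LinearMap.id) (p := 0)
      ⟨?_, Function.surjective_id, ?_, ?_⟩
    · intro x
      exact ⟨fun hx => ⟨0, hx.symm⟩, by rintro ⟨_, rfl⟩; rfl⟩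
    · intro φ
      exact ⟨fun _ => ⟨0, Subsingleton.elim _ _⟩, fun _ => rfl⟩
    · exact fun _ => ⟨0, Subsingleton.elim (α := PUnit.{u + 1}) _ _⟩
  have s2 : StIso O (syz O) := by
    refine StIso.of_syzPres (P := PUnit.{u + 1}) (i := 0) (π := 0) ⟨?_, ?_, ?_⟩
    · exact fun _ _ _ => Subsingleton.elim (α := PUnit.{u + 1}) _ _
    · exact fun _ => ⟨fun _ => ⟨0, rfl⟩, fun _ => rfl⟩
    · exact fun x => ⟨0, Subsingleton.elim (α := PUnit.{u + 1}) _ _⟩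
  exact StIso.projective (s2.trans s1.map_syz)
    (inferInstanceAs (Module.Projective B PUnit.{u + 1}))

end Projective

/-! ### The embedding of modules of positive grade in the stable category -/

section GradeEmbedding

variable {B : Type u} [Ring B] {D : Type u} [AddCommGroup D] [Module B D]

lemma starProp_of_grdProp {n : ℕ} {N : FGModuleCat.{u} B} (h : grdProp B D n N) :
    starProp (grdProp B D n) (projProp B) N :=
  ⟨N, FGModuleCat.of B PUnit.{u + 1}, LinearMap.id, 0, h,
    inferInstanceAs (Module.Projective B PUnit.{u + 1}), Function.injective_id,
    fun x => ⟨fun _ => ⟨x, rfl⟩, fun _ => rfl⟩,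
    fun _ => ⟨0, Subsingleton.elim (α := PUnit.{u + 1}) _ _⟩⟩

variable (B D) in
/-- The functor from modules of grade at least `n` to the stable category. -/
def grdToStable (n : ℕ) : (grdProp B D n).FullSubcategory ⥤
    Stable (starProp (grdProp B D n) (projProp B)) :=
  (stableProp _).lift ((grdProp B D n).ι ⋙ toStable B) fun N => starProp_of_grdProp N.property

lemma grdToStable_full (n : ℕ) : (grdToStable B D n).Full where
  map_surjective {M N} f := by
    obtain ⟨g, hg⟩ := (toStable B).map_surjective f.hom
    exact ⟨ObjectProperty.homMk g, ObjectProperty.hom_ext _ hg⟩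

/-- A module without nonzero homomorphisms to `D` has none to a projective module. -/
lemma eq_zero_of_dual_eq_zero (A : Type u) [Ring A] [Module A D] [SMulCommClass A B D]
    [SMulCommClass B A D] [IsEndRing B A D] {M Q : Type u} [AddCommGroup M] [Module B M]
    [AddCommGroup Q] [Module B Q] [Module.Finite B Q] [Module.Projective B Q]
    (h : ∀ φ : M →ₗ[B] D, φ = 0) (a : M →ₗ[B] Q) : a = 0 := by
  ext m
  apply (evMap_bijective B A D Q).1
  rw [LinearMap.zero_apply, map_zero]
  ext φ
  exact LinearMap.congr_fun (h (φ ∘ₗ a)) m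

/-- Grade at least 1 means zero dual, so no nonzero map out of M factors through a projective. -/
lemma grdToStable_faithful (A : Type u) [Ring A] [Module A D] [SMulCommClass A B D]
    [SMulCommClass B A D] [IsEndRing B A D] (k : ℕ) : (grdToStable B D (k + 1)).Faithful where
  map_injective {M N} f g h := by
    have e : (toStable B).map f.hom = (toStable B).map g.hom := congrArg (fun t => t.hom) h
    obtain ⟨Q, hQ, a, b, hab⟩ := (CategoryTheory.Quotient.functor_map_eq_iff _ _ _).1 e
    have : Module.Projective B Q := hQ
    have ha : a = 0 := eq_zero_of_dual_eq_zero A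
      (ev_zero_iff.1 (grdProp_iff.1 M.property 0 (by omega))) a
    rw [ha, LinearMap.comp_zero, sub_eq_zero] at hab
    exact ObjectProperty.hom_ext _ (ObjectProperty.hom_ext _ (ModuleCat.hom_ext hab))

end GradeEmbedding

/-! ### `Ext` as a duality between spherical modules and modules of large grade -/

section Grade

variable {A : Type u} [Ring A] [IsNoetherianRing A] {B : Type u} [Ring B] [IsNoetherianRing B]
  {D : Type u} [AddCommGroup D] [Module A D] [Module B D] [SMulCommClass A B D]
  [SMulCommClass B A D] [IsEndRing A B D] [IsEndRing B A D]
  [Module.Finite A D] [Module.Projective A D] [Module.Finite B D] [Module.Projective B D]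

variable (A B D) in
/-- The natural transformation from `Extᵏ⁺¹(-, D)` to `Tr Ωᵏ`. -/
def extTrans (k : ℕ) : extFG A B D k ⋙ toStable B ⟶ trSyz A B D k :=
  Functor.whiskerRight (extFGIso A B D k).inv (toStable B) ≫
    Functor.whiskerLeft (syzPow A k).op (extOneTrans A B D)

lemma isIso_extTrans (k : ℕ) (M : FGModuleCat.{u} A) (h : projProp A (nsyz (k + 1) M)) :
    IsIso ((extTrans A B D k).app (Opposite.op ((toStable A).obj M))) := by
  have h1 : IsIso ((extOneTrans A B D).app
      (Opposite.op ((syzPow A k).obj ((toStable A).obj M)))) := by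
    rw [syzPow_obj]
    exact isIso_extOneToTr B D (nsyz k M) h
  exact IsIso.comp_isIso' (inferInstanceAs (IsIso ((toStable B).map
    ((extFGIso A B D k).inv.app (Opposite.op ((toStable A).obj M)))))) h1

/-- As ΩY is reflexive, a functional on Ext¹(Y, D) pulls back on (ΩY)* to evaluation at some q in
ΩY. It kills the restrictions of functionals on P₀, so q vanishes in P₀, hence q = 0. -/
lemma extOne_dual_eq_zero (Y : FGModuleCat.{u} A) (h : projProp A (syz Y))
    (φ : extOne B D Y →ₗ[B] D) : φ = 0 := by
  have : Module.Projective A (syz Y) := h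
  obtain ⟨q, hq⟩ := (evMap_bijective A B D (syz Y)).2 (φ ∘ₗ extPr B D Y)
  have h0 : syzIncl Y q = 0 := by
    apply (evMap_bijective A B D (Cover Y)).1
    rw [map_zero]
    ext χ
    have h1 := LinearMap.congr_fun hq (χ ∘ₗ syzIncl Y)
    have h2 : extPr B D Y (χ ∘ₗ syzIncl Y) = 0 := (exact_deltaLin B D Y _).2 ⟨χ, rfl⟩
    rw [LinearMap.comp_apply, h2, map_zero] at h1
    exact h1
  have hq0 : q = 0 := syzIncl_injective Y (h0.trans (map_zero (syzIncl Y)).symm)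
  rw [hq0, map_zero] at hq
  refine (LinearMap.cancel_right (extPr_surjective B D Y)).1 ?_
  rw [← hq, LinearMap.zero_comp]

/-- `Extᵏ⁺¹(M, D)` has grade at least `k + 1` if `M` is `(k + 1)`-spherical. -/
lemma grdProp_ext (k : ℕ) (M : FGModuleCat.{u} A) (hM : sphProp A D (k + 1) (projProp A) M) :
    grdProp B D (k + 1) ((extFG A B D k).obj (Opposite.op ((toStable A).obj M))) := by
  refine grdProp_iff.2 fun i hi => ?_
  cases i with
  | zero =>
    refine ev_zero_iff.2 fun φ => ?_
    -- Vanishing in degree 0 is not a stable invariant, so a genuine isomorphism of modules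
    -- Ext¹(ΩᵏM, D) ≅ Extᵏ⁺¹(M, D) is needed here.
    have e : (extFG A B D 0).obj (Opposite.op ((syzPow A k).obj ((toStable A).obj M))) ≅
      (extFG A B D k).obj (Opposite.op ((toStable A).obj M)) :=
      (extFGIso A B D k).app (Opposite.op ((toStable A).obj M))
    rw [syzPow_obj] at e
    have h0 := extOne_dual_eq_zero (B := B) (nsyz k M) hM.2 (φ ∘ₗ e.hom.hom.hom)
    ext x
    have h1 := LinearMap.congr_fun h0 (e.inv.hom.hom x)
    have h2 : e.hom.hom.hom (e.inv.hom.hom x) = x :=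
      congrArg (fun t => t.hom.hom x) e.inv_hom_id
    rw [LinearMap.comp_apply, h2] at h1
    exact h1
  | succ i =>
    -- In positive degrees the stable isomorphism with Tr ΩᵏM suffices.
    have h1 := isIso_extTrans (B := B) (D := D) k M hM.2
    have e : (toStable B).obj ((extFG A B D k).obj (Opposite.op ((toStable A).obj M))) ≅
      (trFunctor A B D).obj (Opposite.op ((syzPow A k).obj ((toStable A).obj M))) :=
      @asIso _ _ _ _ _ h1
    rw [syzPow_obj] at e
    have e' : StIso ((extFG A B D k).obj (Opposite.op ((toStable A).obj M)))
      (tr B D (nsyz k M)) := ⟨e⟩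
    exact e'.symm.ev A (ev_tr_nsyz k M (fun j hj => hM.1 (j + 1) (by omega) (by omega))
      (by omega))

variable (A B D) in
/-- The functor `Extᵏ⁺¹(-, D)` from `(k + 1)`-spherical modules to modules of grade at least
`k + 1`. -/
def sphExt (k : ℕ) : (Stable (sphProp A D (k + 1) (projProp A)))ᵒᵖ ⥤
    (grdProp B D (k + 1)).FullSubcategory :=
  (grdProp B D (k + 1)).lift ((stableIncl _).op ⋙ extFG A B D k) fun M =>
    grdProp_ext k M.unop.obj.as M.unop.property

/-- `Extᵏ⁺¹(-, D)` is a duality between the stable category of `(k + 1)`-spherical modules and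
modules of grade at least `k + 1`, with quasi-inverse `Tr Ωᵏ`. -/
theorem exists_equiv_sph_grd (k : ℕ) :
    ∃ E : (Stable (sphProp A D (k + 1) (projProp A)))ᵒᵖ ≌
        (grdProp B D (k + 1)).FullSubcategory,
      Nonempty (E.functor ⋙ (grdProp B D (k + 1)).ι ⋙ (ModuleCat.isFG B).ι ≅
        (stableIncl (sphProp A D (k + 1) (projProp A))).op ⋙
          stableExt A B D (k + 1) (by omega)) ∧
      Nonempty (E.inverse ⋙ (stableIncl (sphProp A D (k + 1) (projProp A))).op ≅
        (grdProp B D (k + 1)).ι ⋙ toStable B ⋙ (trSyz B A D k).rightOp) := by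
  obtain ⟨E₀, ⟨e₁⟩, ⟨e₂⟩⟩ := exists_equiv_sph_star (A := A) (B := B) (D := D)
    (X := projProp A) (X' := projProp B) k (fun _ _ => StIso.projective)
    (fun _ _ => StIso.projective) (fun _ => projective_syz_tr) (fun _ => projective_syz_tr)
    (fun M hM i _ => by
      have : Module.Projective B M := hM
      exact ev_of_projective i)
  let J := grdToStable B D (k + 1)
  have : J.Full := grdToStable_full _
  have : J.Faithful := grdToStable_faithful A k
  have ψ' : (sphExt A B D k ⋙ J) ⋙ stableIncl (starProp (grdProp B D (k + 1)) (projProp B)) ≅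
      (stableIncl (sphProp A D (k + 1) (projProp A))).op ⋙ trSyz A B D k :=
    NatIso.ofComponents (fun M => @asIso _ _ _ _ ((extTrans A B D k).app (Opposite.op M.unop.obj))
      (isIso_extTrans k M.unop.obj.as M.unop.property.2))
      fun f => (extTrans A B D k).naturality f.unop.hom.op
  have ψ : sphExt A B D k ⋙ J ≅ E₀.functor :=
    Functor.fullyFaithfulCancelRight (stableIncl _) (ψ' ≪≫ e₁.symm)
  -- A preimage of Y is Extᵏ⁺¹ of the spherical module corresponding to Y, since J after Ext is
  -- stably Tr Ωᵏ.
  have : J.EssSurj := ⟨fun Y => by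
    refine ⟨(sphExt A B D k).obj (E₀.inverse.obj Y), ⟨?_⟩⟩
    exact ψ.app (E₀.inverse.obj Y) ≪≫ E₀.counitIso.app Y⟩
  have : J.IsEquivalence := { }
  refine ⟨E₀.trans J.asEquivalence.symm, ⟨?_⟩, ⟨?_⟩⟩
  · have e : E₀.functor ⋙ J.inv ≅ sphExt A B D k :=
      Functor.isoWhiskerRight ψ.symm J.inv ≪≫
        Functor.isoWhiskerLeft (sphExt A B D k) J.asEquivalence.unitIso.symm
    exact Functor.isoWhiskerRight e ((grdProp B D (k + 1)).ι ⋙ (ModuleCat.isFG B).ι)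
  · exact Functor.isoWhiskerLeft J e₂

end Grade

/-! ### The regular bimodule as a dualizing bimodule -/

section Regular

variable (R : Type u) [Ring R]

instance : IsEndRing R Rᵐᵒᵖ R where
  bijective := by
    constructor
    · intro a b h
      simpa [smulEnd] using LinearMap.congr_fun h 1
    · intro f
      refine ⟨f 1, LinearMap.ext fun x => ?_⟩
      have := f.map_smul (MulOpposite.op x) 1
      simpa [smulEnd] using this.symm

instance : IsEndRing Rᵐᵒᵖ R R where
  bijective := by
    constructor
    · intro a b h
      simpa [smulEnd] using LinearMap.congr_fun h 1
    · intro f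
      refine ⟨MulOpposite.op (f 1), LinearMap.ext fun x => ?_⟩
      have := f.map_smul x 1
      simpa [smulEnd] using this.symm

end Regular

lemma ev_of_gProp {A : Type u} [Ring A] [IsNoetherianRing A] {B : Type u} [Ring B]
    {D : Type u} [AddCommGroup D] [Module A D] [Module B D] [SMulCommClass A B D]
    [Module.Finite B D] {m l : ℕ∞} {n : ℕ} (hm : (n : ℕ∞) ≤ m) {M : FGModuleCat.{u} A}
    (h : gProp A B D m l M) (i : ℕ) (hi : i < n) : EV A D M (i + 1) :=
  h.1 (i + 1) (by omega) (le_trans (by exact_mod_cast hi) hm)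

end StableMod

end

open StableMod
theorem theorem2p7 (R : Type u) [Ring R] [IsNoetherianRing R] [IsNoetherianRing Rᵐᵒᵖ]
    (n : ℕ) (hn : 1 ≤ n) :
    (∃ E : (Stable (sphProp Rᵐᵒᵖ R n (projProp Rᵐᵒᵖ)))ᵒᵖ ≌ (grdProp R R n).FullSubcategory,
      Nonempty (E.functor ⋙ (grdProp R R n).ι ⋙ (ModuleCat.isFG R).ι ≅
        (stableIncl (sphProp Rᵐᵒᵖ R n (projProp Rᵐᵒᵖ))).op ⋙ stableExt Rᵐᵒᵖ R R n hn) ∧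
      Nonempty (E.inverse ⋙ (stableIncl (sphProp Rᵐᵒᵖ R n (projProp Rᵐᵒᵖ))).op ≅
        (grdProp R R n).ι ⋙ toStable R ⋙ (trSyz R Rᵐᵒᵖ R (n - 1)).rightOp)) ∧
    (∀ m : ℕ∞, (n : ℕ∞) ≤ m →
      ∃ E : (Stable (sphProp Rᵐᵒᵖ R n (gProp Rᵐᵒᵖ R R m (m + 1))))ᵒᵖ ≌
          Stable (starProp (grdProp R R n) (gProp R Rᵐᵒᵖ R m (m + 1))),
        Nonempty (E.functor ⋙
            stableIncl (starProp (grdProp R R n) (gProp R Rᵐᵒᵖ R m (m + 1))) ≅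
          (stableIncl (sphProp Rᵐᵒᵖ R n (gProp Rᵐᵒᵖ R R m (m + 1)))).op ⋙
            trSyz Rᵐᵒᵖ R R (n - 1)) ∧
        Nonempty (E.inverse ⋙
            (stableIncl (sphProp Rᵐᵒᵖ R n (gProp Rᵐᵒᵖ R R m (m + 1)))).op ≅
          stableIncl (starProp (grdProp R R n) (gProp R Rᵐᵒᵖ R m (m + 1))) ⋙
            (trSyz R Rᵐᵒᵖ R (n - 1)).rightOp)) ∧
    (∃ E : (Stable (sphProp Rᵐᵒᵖ R n (totReflProp Rᵐᵒᵖ R R)))ᵒᵖ ≌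
        Stable (starProp (grdProp R R n) (totReflProp R Rᵐᵒᵖ R)),
      Nonempty (E.functor ⋙ stableIncl (starProp (grdProp R R n) (totReflProp R Rᵐᵒᵖ R)) ≅
        (stableIncl (sphProp Rᵐᵒᵖ R n (totReflProp Rᵐᵒᵖ R R))).op ⋙ trSyz Rᵐᵒᵖ R R (n - 1)) ∧
      Nonempty (E.inverse ⋙ (stableIncl (sphProp Rᵐᵒᵖ R n (totReflProp Rᵐᵒᵖ R R))).op ≅
        stableIncl (starProp (grdProp R R n) (totReflProp R Rᵐᵒᵖ R)) ⋙
          (trSyz R Rᵐᵒᵖ R (n - 1)).rightOp)) := by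
  -- With n = k + 1 the exponent n - 1 reduces to k.
  obtain ⟨k, rfl⟩ := Nat.exists_eq_add_of_le' hn
  have h2 : ∀ m : ℕ∞, ((k + 1 : ℕ) : ℕ∞) ≤ m → _ := fun m hm =>
    exists_equiv_sph_star (A := Rᵐᵒᵖ) (B := R) (D := R) (X := gProp Rᵐᵒᵖ R R m (m + 1))
      (X' := gProp R Rᵐᵒᵖ R m (m + 1)) k (fun _ _ => StIso.gProp) (fun _ _ => StIso.gProp)
      (fun _ => gProp_syz_tr) (fun _ => gProp_syz_tr) (fun _ hM => ev_of_gProp hm hM)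
  refine ⟨exists_equiv_sph_grd k, h2, ?_⟩
  -- Totally reflexive modules form 𝒢_{∞,∞+1} on both sides, so part 3 is part 2 for m = ∞.
  rw [totReflProp_eq_gProp, totReflProp_eq_gProp]
  exact h2 ⊤ le_top
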